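/- **Setting.** Conventions: $0\ln 0=0$ and $\ln 0=0$. A *single-call recurrence* is given by an expression $\mathfrak t$ built by $\mathfrak t::= c\mid n\mid \ln n\mid n\ln n\mid \mathfrak t+\mathfrak t\mid c\cdot\mathfrak t\mid \frac1n\sum_{i=0}^{n-1}\mathcal T(i)\mid \frac1n\big(\sum_{i=\lfloor n/2\rfloor}^{n-1}\mathcal T(i)+\sum_{i=\lceil n/2\rceil}^{n-1}\mathcal T(i)\big)$ with real constants $c$. Let $a(n)$ be its non-sum part and let $\beta,\gamma$ be the total coefficients of the first and the second sum; assume $\beta,\gamma\ge 0$, $\beta+\gamma=1$. Then $h(n)\in\{0,\dots,n-1\}$ is the random size with $\Pr[h(n)=i]=\frac{\beta}{n}+\frac{\gamma}{n}\big(\mathbf 1_{i\ge\lfloor n/2\rfloor}+\mathbf 1_{i\ge\lceil n/2\rceil}\big)$, and $\mathcal T(0)=\mathcal T(1)=0$ and, for $n>1$, $\mathcal T(n)=a(n)+\mathcal T(h(n))$ in law. Let $f$ and $\kappa$ be expressions generated by $E::=c\mid E+E\mid c\cdot E\mid n\ln n\mid \ln n\mid n$, with $f(n)\ge\mathbb E[\mathcal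 T(n)]$ for all $n\in\mathbb N$, and let $n^*\ge 1$. **The algorithm.** On input $\mathfrak t$, $f$, $n^*$: *Steps 1–2.* Form $\alpha^{f(n)}\ge \alpha^{a(n)}\,\mathbb E[\alpha^{f(h(n))}]$ and over-approximate the sums, giving one of the following. - If $f(n)=qn+d$, $q>0$: $\alpha^{f(n)}\ge\frac{\alpha^{a(n)+d}}{n\,q\ln\alpha}\big(2\gamma(\alpha^{qn}-\alpha^{qn/2})+\beta(\alpha^{qn}-1)\big)$, with $g(n)=n$. - If $f(n)=r\ln n+d$, $r>0$, and $a$ is constant: $\alpha^{f(n)}\ge\frac{\alpha^{a+f(n)}}{1+r\ln\alpha}\big(\gamma(2-\alpha^{-r\ln 2})+\beta\big)$, with $g(n)=1$. - Sampling: $\alpha^{f(n)}\ge \alpha^{a(n)}\big(\frac{\theta\gamma}{B}\sum_{j=1}^B\alpha^{f(n(B+j)/(2B))}+\frac{\beta}{B}\sum_{j=1}^B\alpha^{f(jn/B)}\big)$ for an integer $B\ge1$ and $\theta\ge1$, with $g$ the most significant term of $f$ without its coefficient. It is applied only if $f$ is nondecreasing on $[1,\infty)$ and, when $\beta\neq0$,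 $f$ has no $\ln n$ term and $f(0)\le f(1)$. *Step 3.* Put $c=\alpha^{g(n)}$, clear the denominators (with $c=\alpha^n$ and $n\ln\alpha=\ln c$ in the first case), move everything to the left, and apply the following simplifications in any order and any number: rewrite $\alpha^{\omega g(n)}$ as $c^\omega$; delete zero terms; divide all terms by a common factor $\alpha^{e(n)}$; and for a term $\mathfrak e_1(c)\cdot c^{\mathfrak e_2(n)}$, where signs are required for all $c\ge1$ and all $1\le n\le n^*$ with $g(n)>0$: replace it by $\mathfrak e_1$ if $\mathfrak e_1,\mathfrak e_2\ge0$ or $\mathfrak e_1,\mathfrak e_2\le0$, and by $\mathfrak e_1\cdot c$ if $\mathfrak e_1\le 0\le \mathfrak e_2\le1$. If $n$ disappears, the result is $\psi(c)\ge0$ with $\psi(c)=\sum_i\mu_i c^{\nu_i}\ln^{\xi_i}c$, $\xi_i\in\{0,1\}$. *Step 4.* Prove $\psi$ separable by the recursive rules: (i) $\psi(1)\ge0$ and $\psi$ is strictly decreasing on $[1,\infty)$; (ii) $\psi(1)\ge0$ and $\psi'$ is proved separable; (iii) $\psi/c^b$ is proved separable for some $b\in\mathbb R$. Then obtain $c^*$,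 either exactly (for all $c\ge1$: $\psi(c)\ge0\iff c\le c^*$) or as the lower end of the last interval of a binary search for the sign change of $\psi$ on $[1,H]$, with any $H>1$ and any number of iterations. *Step 5.* Choose $\alpha$ with $\alpha>1$ and $\alpha^{g(n^*)}\le c^*$ (for instance the largest one), and report $\Pr[\mathcal T(n^*)\ge\kappa]\le\alpha^{f(n^*)-\kappa(n^*)}$ for all $\kappa$ with $\kappa(n^*)\ge f(n^*)$. On failure report the trivial bound $1$. **Theorem (Soundness).** Every bound that the algorithm may report is correct: if it reports $\alpha$, then $$\Pr[\mathcal T(n^*)\ge\kappa(n^*)]\le\alpha^{f(n^*)-\kappa(n^*)}\quad\text{for all }\kappa\text{ in the grammar with }\kappa(n^*)\ge f(n^*),$$ and if it fails, $\Pr[\mathcal T(n^*)\ge\kappa(n^*)]\le 1$. -/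

import Mathlib

open MeasureTheory

namespace TailBound

/-! ### Input grammars -/

/-- A normalised non-sum expression `nlog * (n ln n) + lin * n + log * ln n + const`. -/
@[ext] structure LogLin where
  nlog : ℝ
  lin : ℝ
  log : ℝ
  const : ℝ

namespace LogLin

/-- Value at a real argument, with the conventions `0 * ln 0 = 0` and `ln 0 = 0`. -/
noncomputable def eval (e : LogLin) (x : ℝ) : ℝ :=
  e.nlog * (x * Real.log x) + e.lin * x + e.log * Real.log x + e.const

noncomputable instance : Zero LogLin := ⟨⟨0, 0, 0, 0⟩⟩

noncomputable instance : Add LogLin :=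
  ⟨fun a b => ⟨a.nlog + b.nlog, a.lin + b.lin, a.log + b.log, a.const + b.const⟩⟩

noncomputable instance : SMul ℝ LogLin :=
  ⟨fun r a => ⟨r * a.nlog, r * a.lin, r * a.log, r * a.const⟩⟩

/-- The expression `n ↦ e (r * n)`, for a constant `r > 0`. -/
noncomputable def scale (e : LogLin) (r : ℝ) : LogLin :=
  ⟨e.nlog * r, e.lin * r + e.nlog * r * Real.log r, e.log, e.log * Real.log r + e.const⟩

/-- The most significant term of `e`, without its coefficient. -/
noncomputable def leadMonomial (e : LogLin) : LogLin :=
  open Classical in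
  if e.nlog ≠ 0 then ⟨1, 0, 0, 0⟩
  else if e.lin ≠ 0 then ⟨0, 1, 0, 0⟩
  else if e.log ≠ 0 then ⟨0, 0, 1, 0⟩
  else ⟨0, 0, 0, 1⟩

end LogLin

/-- The grammar `E ::= c | E + E | c * E | n * ln n | ln n | n` for `κ` and `f`. -/
inductive GExpr where
  | const (c : ℝ)
  | size
  | lnN
  | nLnN
  | add (e₁ e₂ : GExpr)
  | smul (c : ℝ) (e : GExpr)

namespace GExpr

/-- Collect the coefficients of an expression. -/
noncomputable def norm : GExpr → LogLin
  | const c => ⟨0, 0, 0, c⟩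
  | size => ⟨0, 1, 0, 0⟩
  | lnN => ⟨0, 0, 1, 0⟩
  | nLnN => ⟨1, 0, 0, 0⟩
  | add e₁ e₂ => norm e₁ + norm e₂
  | smul c e => c • norm e

/-- The function denoted by an expression. -/
noncomputable def eval : GExpr → ℝ → ℝ
  | const c, _ => c
  | size, x => x
  | lnN, x => Real.log x
  | nLnN, x => x * Real.log x
  | add e₁ e₂, x => eval e₁ x + eval e₂ x
  | smul c e, x => c * eval e x

end GExpr

/-- The grammar of right-hand sides of single-call recurrences.  `fullSum` is
`(1/n) * ∑_{i=0}^{n-1} T(i)` and `halfSum` is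
`(1/n) * (∑_{i=⌊n/2⌋}^{n-1} T(i) + ∑_{i=⌈n/2⌉}^{n-1} T(i))`. -/
inductive RecExpr where
  | const (c : ℝ)
  | size
  | lnN
  | nLnN
  | add (t₁ t₂ : RecExpr)
  | smul (c : ℝ) (t : RecExpr)
  | fullSum
  | halfSum

namespace RecExpr

/-- The non-sum part `a(n)`. -/
noncomputable def cost : RecExpr → LogLin
  | const c => ⟨0, 0, 0, c⟩
  | size => ⟨0, 1, 0, 0⟩
  | lnN => ⟨0, 0, 1, 0⟩
  | nLnN => ⟨1, 0, 0, 0⟩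
  | add t₁ t₂ => cost t₁ + cost t₂
  | smul c t => c • cost t
  | fullSum => 0
  | halfSum => 0

/-- The total coefficient of `fullSum`. -/
noncomputable def fullWeight : RecExpr → ℝ
  | add t₁ t₂ => fullWeight t₁ + fullWeight t₂
  | smul c t => c * fullWeight t
  | fullSum => 1
  | _ => 0

/-- The total coefficient of `halfSum`. -/
noncomputable def halfWeight : RecExpr → ℝ
  | add t₁ t₂ => halfWeight t₁ + halfWeight t₂
  | smul c t => c * halfWeight t
  | halfSum => 1
  | _ => 0

/-- `t` has the form `a(n) + T(h(n))` for a random size `h(n)`: no sum has a negative coefficient,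
and the weights of the sums make up a probability distribution. -/
structure IsSingleCall (t : RecExpr) : Prop where
  full_nonneg : 0 ≤ t.fullWeight
  half_nonneg : 0 ≤ t.halfWeight
  total : t.fullWeight + t.halfWeight = 1

/-- `Pr[h(n) = i]`, for `i < n`; here `n / 2` is `⌊n/2⌋` and `(n + 1) / 2` is `⌈n/2⌉`. -/
noncomputable def callProb (t : RecExpr) (n i : ℕ) : ℝ :=
  t.fullWeight / n +
    t.halfWeight / n * ((if n / 2 ≤ i then 1 else 0) + (if (n + 1) / 2 ≤ i then 1 else 0))

/-- The law of `T(n)`: `T(0) = T(1) = 0`, and for `n > 1`, `T(n)` is distributed as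
`a(n) + T(h(n))`, that is, as the mixture with weights `Pr[h(n) = i]` of the laws of
`a(n) + T(i)`. -/
noncomputable def law (t : RecExpr) : ℕ → Measure ℝ
  | 0 => Measure.dirac 0
  | 1 => Measure.dirac 0
  | n + 2 => ∑ i : Fin (n + 2), ENNReal.ofReal (t.callProb (n + 2) i) •
      (law t i).map (fun x => t.cost.eval ((n + 2 : ℕ) : ℝ) + x)
  termination_by n => n
  decreasing_by exact i.2

end RecExpr

/-! ### Univariate functions `ψ(c) = ∑ μ * c ^ ν * (ln c) ^ ξ`, with `ξ ∈ {0, 1}` -/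

/-- One summand `μ * c ^ ν * (ln c) ^ ξ`; `withLog` says that `ξ = 1`. -/
structure PsiTerm where
  μ : ℝ
  ν : ℝ
  withLog : Bool

/-- A sum of such summands. -/
abbrev Psi := List PsiTerm

namespace Psi

noncomputable def eval (ψ : Psi) (c : ℝ) : ℝ :=
  (ψ.map fun s => s.μ * c ^ s.ν * (if s.withLog then Real.log c else 1)).sum

/-- Symbolic product with `c ^ a`. -/
noncomputable def mulPow (ψ : Psi) (a : ℝ) : Psi :=
  ψ.map fun s => ⟨s.μ, s.ν + a, s.withLog⟩

/-- Symbolic derivative with respect to `c`. -/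
noncomputable def deriv (ψ : Psi) : Psi :=
  ψ.flatMap fun s =>
    ⟨s.μ * s.ν, s.ν - 1, s.withLog⟩ :: (if s.withLog then [⟨s.μ, s.ν - 1, false⟩] else [])

end Psi

/-! ### Symbolic inequalities in `c` and `n` -/

/-- The term `coeff(c) * α ^ exp(n)`.  With the substitution `c = α ^ g(n)`, this is
`coeff(c) * c ^ (exp(n) / g(n))`. -/
structure Term where
  coeff : Psi
  exp : LogLin

/-- **Steps 1 and 2, and the beginning of Step 3.**

Step 1 is the inequality
`α^f(n) ≥ α^a(n) * (full/n * ∑_{i<n} α^f(i)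
    + half/n * (∑_{⌊n/2⌋≤i<n} α^f(i) + ∑_{⌈n/2⌉≤i<n} α^f(i)))`.
Step 2 replaces each sum by an over-approximation, and Step 3 introduces `c = α ^ g(n)`,
multiplies by the denominators and moves everything to the left.
`Start a full half f g e` says that the outcome is the inequality `∑_{τ ∈ e} τ ≥ 0`, with
`g` as the exponent of the substitution. -/
inductive Start (a : LogLin) (full half : ℝ) (f : LogLin) : LogLin → List Term → Prop
  /-- `f(n) = q * n + d`.  Integration, with the floors and ceilings removed, gives
  `α^f(n) ≥ α^(a(n)+d) / (n * q * ln α)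
      * (half * (2 * α^(q*n) - 2 * α^(q*n/2)) + full * (α^(q*n) - 1))`;
  now `c = α ^ n` and `n * ln α = ln c`. -/
  | linear (hnlog : f.nlog = 0) (hlog : f.log = 0) (hlin : 0 < f.lin) :
      Start a full half f ⟨0, 1, 0, 0⟩
        [⟨[⟨f.lin, 0, true⟩], f⟩,
         ⟨[⟨-(2 * half), f.lin, false⟩, ⟨2 * half, f.lin / 2, false⟩,
            ⟨-full, f.lin, false⟩, ⟨full, 0, false⟩], a + ⟨0, 0, 0, f.const⟩⟩]
  /-- `f(n) = r * ln n + d` and `a(n)` is a constant.  Integration, with the floors and ceilings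
  removed, gives
  `α^f(n) ≥ α^(a(n)+f(n)) / (1 + r * ln α) * (half * (2 - α^(-r*ln 2)) + full)`;
  after the cancellation of the powers of `n` the variable is `α` itself, so `c = α`. -/
  | logarithmic (hnlog : f.nlog = 0) (hlin : f.lin = 0) (hlog : 0 < f.log)
      (hann : a.nlog = 0) (han : a.lin = 0) (hal : a.log = 0) :
      Start a full half f ⟨0, 0, 0, 1⟩
        [⟨[⟨1, 0, false⟩, ⟨f.log, 0, true⟩], f⟩,
         ⟨[⟨-(2 * half), 0, false⟩, ⟨half, -(f.log * Real.log 2), false⟩, ⟨-full, 0, false⟩],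
            a + f⟩]
  /-- Sampling with `B` parts, where the largest element of a part is taken at its right end:
  `α^f(n) ≥ α^a(n) * (θ * half / B * ∑_{j=1}^B α^f(n*(B+j)/(2*B))
      + full / B * ∑_{j=1}^B α^f(j*n/B))`.
  This relies on monotonicity: `f` has to increase on `[1, ∞)`, and, if the summation starts at
  `i = 0`, `f` must be continuous at `0` (no term `ln n`) with `f(0) ≤ f(1)`.
  The factor `θ ≥ 1` is `1` when every part of `[n/2, n]` is counted with its length `n / (2 * B)`,
  and `2` when it is counted with `n / B`. -/
  | sampled (B : ℕ) (hB : 0 < B) (θ : ℝ) (hθ : 1 ≤ θ)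
      (hmono : MonotoneOn f.eval (Set.Ici 1))
      (hzero : full ≠ 0 → f.log = 0 ∧ f.eval 0 ≤ f.eval 1) :
      Start a full half f f.leadMonomial
        (⟨[⟨B, 0, false⟩], f⟩ ::
          (List.range B).flatMap fun j =>
            [⟨[⟨-(θ * half), 0, false⟩], a + f.scale ((B + (j + 1)) / (2 * B))⟩,
             ⟨[⟨-full, 0, false⟩], a + f.scale ((j + 1) / B)⟩])

/-- The sizes `1 ≤ n ≤ N` at which exponents `e(n) / g(n)` of `c` are formed. -/
def sizes (g : LogLin) (N : ℕ) : Set ℕ := {n | 1 ≤ n ∧ n ≤ N ∧ 0 < g.eval n}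

/-- **Step 3**, simplification of one term `e₁ * c ^ e₂`, where `e₂ = e(n) / g(n)`. -/
inductive TermStep (g : LogLin) (N : ℕ) : Term → Term → Prop
  /-- `α ^ (ω * g(n))` is rewritten as `c ^ ω`. -/
  | subst (W : Psi) (E : LogLin) (ω : ℝ) :
      TermStep g N ⟨W, E + ω • g⟩ ⟨W.mulPow ω, E⟩
  /-- If `e₁` and `e₂` are both nonnegative, `e₁ * c ^ e₂` is simplified to `e₁`. -/
  | dropPos (W : Psi) (E e : LogLin) (hW : ∀ c : ℝ, 1 ≤ c → 0 ≤ W.eval c)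
      (he : ∀ n ∈ sizes g N, 0 ≤ e.eval n) : TermStep g N ⟨W, E + e⟩ ⟨W, E⟩
  /-- If `e₁` and `e₂` are both nonpositive, `e₁ * c ^ e₂` is simplified to `e₁`. -/
  | dropNeg (W : Psi) (E e : LogLin) (hW : ∀ c : ℝ, 1 ≤ c → W.eval c ≤ 0)
      (he : ∀ n ∈ sizes g N, e.eval n ≤ 0) : TermStep g N ⟨W, E + e⟩ ⟨W, E⟩
  /-- If `e₁ ≤ 0 ≤ e₂ ≤ 1`, `e₁ * c ^ e₂` is simplified to `e₁ * c`. -/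
  | round (W : Psi) (E e : LogLin) (hW : ∀ c : ℝ, 1 ≤ c → W.eval c ≤ 0)
      (he : ∀ n ∈ sizes g N, 0 ≤ e.eval n ∧ e.eval n / g.eval n ≤ 1) :
      TermStep g N ⟨W, E + e⟩ ⟨W.mulPow 1, E⟩

/-- **Step 3**, simplification of the inequality `∑_{τ ∈ e} τ ≥ 0`. -/
inductive Step (g : LogLin) (N : ℕ) : List Term → List Term → Prop
  /-- One term is simplified. -/
  | term (l₁ l₂ : List Term) (τ τ' : Term) (h : TermStep g N τ τ') :
      Step g N (l₁ ++ τ :: l₂) (l₁ ++ τ' :: l₂)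
  /-- A term with coefficient zero is deleted. -/
  | zero (l₁ l₂ : List Term) (τ : Term) (h : ∀ c : ℝ, 1 ≤ c → τ.coeff.eval c = 0) :
      Step g N (l₁ ++ τ :: l₂) (l₁ ++ l₂)
  /-- Division by a common factor `α ^ e(n)`. -/
  | gcd (l : List Term) (e : LogLin) :
      Step g N (l.map fun τ => ⟨τ.coeff, τ.exp + e⟩) l

/-- **Steps 1–3.**  The inequality for `t` and `f` is simplified to `ψ(c) ≥ 0`, with
`c = α ^ g(n)`, where `n` no longer occurs in `ψ`. -/
def ReducesTo (t : RecExpr) (f : GExpr) (N : ℕ) (g : LogLin) (ψ : Psi) : Prop :=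
  ∃ e₀ e₁ : List Term,
    Start t.cost t.fullWeight t.halfWeight f.norm g e₀ ∧
    Relation.ReflTransGen (Step g N) e₀ e₁ ∧
    (∀ τ ∈ e₁, τ.exp = 0) ∧
    ψ = e₁.flatMap Term.coeff

/-! ### Step 4 -/

/-- The recursive separability check on `ψ`. -/
inductive ProvedSeparable : Psi → Prop
  | decreasing (ψ : Psi) (h1 : 0 ≤ ψ.eval 1) (h : StrictAntiOn ψ.eval (Set.Ici 1)) :
      ProvedSeparable ψ
  | deriv (ψ : Psi) (h1 : 0 ≤ ψ.eval 1) (h : ProvedSeparable ψ.deriv) : ProvedSeparable ψ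
  | divPow (ψ : Psi) (a : ℝ) (h : ProvedSeparable (ψ.mulPow (-a))) : ProvedSeparable ψ

open Classical in
/-- Binary search on `[lo, hi]` for the sign change of `ψ`, with `k` iterations; the lower end of
the last interval is returned. -/
noncomputable def bisect (ψ : Psi) : ℝ → ℝ → ℕ → ℝ
  | lo, _, 0 => lo
  | lo, hi, k + 1 =>
      if 0 ≤ ψ.eval ((lo + hi) / 2) then bisect ψ ((lo + hi) / 2) hi k
      else bisect ψ lo ((lo + hi) / 2) k

/-- The values that Step 4 may return for `c*`: the exact one, or one found by binary search. -/
inductive Threshold (ψ : Psi) : ℝ → Prop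
  | exact (c : ℝ) (h : ∀ x : ℝ, 1 ≤ x → (0 ≤ ψ.eval x ↔ x ≤ c)) : Threshold ψ c
  | search (hi : ℝ) (hhi : 1 < hi) (k : ℕ) : Threshold ψ (bisect ψ 1 hi k)

/-! ### The algorithm -/

/-- `Synthesizes t f N out`: on the recurrence `t`, the bound `f` on the expected runtime and the
initial size `N`, the algorithm may return `out`.  Here `none` is the trivial answer and `some α`
is the base found in **Step 5**, any solution of `α > 1` and `α ^ g(N) ≤ c*` (so, in particular,
the largest one). -/
inductive Synthesizes (t : RecExpr) (f : GExpr) (N : ℕ) : Option ℝ → Prop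
  | failure : Synthesizes t f N none
  | success (g : LogLin) (ψ : Psi) (c α : ℝ)
      (hψ : ReducesTo t f N g ψ) (hsep : ProvedSeparable ψ) (hc : Threshold ψ c)
      (hα : 1 < α) (hαc : α ^ g.eval N ≤ c) : Synthesizes t f N (some α)

/-- The reported bound on `Pr[T(N) ≥ k]`: the trivial bound `1`, or `α ^ (f(N) - k)`. -/
noncomputable def reportedBound (f : GExpr) (N : ℕ) (k : ℝ) : Option ℝ → ℝ
  | none => 1
  | some α => α ^ (f.eval N - k)

end TailBound

namespace TailBound

namespace LogLin

/-! The proof is the exponential moment method. Markov's inequality for `α ^ x` reduces the tail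
bound to `E[α ^ T(N)] ≤ α ^ f(N)`. By strong induction on the size, `E[α ^ T(n)] ≤ F n` for every
nonnegative `F` with `F 0, F 1 ≥ 1` and `F n ≥ α ^ a(n) * E[F (h(n))]` for `2 ≤ n ≤ N`, so it is
enough to find such an `F` with `F N ≤ α ^ f(N)`.

The choice of `α` supplies the starting symbolic inequality at all these sizes. A separable `ψ`
changes sign at most once on `[1, ∞)`, from `+` to `-`, so `ψ ≥ 0` on `[1, c*]`. Since `g` is
positive beyond `1` and nondecreasing, `1 ≤ α ^ g(n) ≤ α ^ g(N) ≤ c*`. No simplification of a term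
increases the left-hand side, and division by a power of `α` preserves its sign, so nonnegativity
travels back to the start (`exists_start_nonneg`).

It remains to pass from the integral or sampled inequality to the recurrence with its floors and
ceilings (`Start.exists_majorant`). For linear `f` and for sampling, `F = α ^ f` works, by geometric
sums and by monotonicity and convexity respectively. For logarithmic `f`, `α ^ f(n) = D * n ^ s`
with `s = r * ln α` may violate the recurrence at small sizes when `s < 1`. It is then replaced by
`F = 1` at sizes `0, 1` and `F n = A * (n / 2) ^ s` beyond, with `A = α ^ a`. This lies below `α ^
f` because `a(2) = E[T(2)] ≤ f(2)`. The hypothesis on expectations is needed only at sizes `0`, `1`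
and `2`. -/

theorem eval_add (a b : LogLin) (x : ℝ) : (a + b).eval x = a.eval x + b.eval x := by
  change (a.nlog + b.nlog) * _ + (a.lin + b.lin) * _ + (a.log + b.log) * _ + (a.const + b.const) = _
  simp only [eval]
  ring

theorem eval_smul (r : ℝ) (a : LogLin) (x : ℝ) : (r • a).eval x = r * a.eval x := by
  change (r * a.nlog) * _ + (r * a.lin) * _ + (r * a.log) * _ + (r * a.const) = _
  simp only [eval]
  ring

theorem eval_zero (x : ℝ) : (0 : LogLin).eval x = 0 := by
  change (0 : ℝ) * _ + 0 * _ + 0 * _ + 0 = _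
  ring

theorem eval_scale (e : LogLin) {r x : ℝ} (hr : 0 < r) (hx : 0 < x) :
    (e.scale r).eval x = e.eval (x * r) := by
  simp only [eval, scale, Real.log_mul hx.ne' hr.ne']
  ring

end LogLin

theorem GExpr.eval_norm (e : GExpr) (x : ℝ) : e.norm.eval x = e.eval x := by
  induction e with
  | const c => simp [norm, eval, LogLin.eval]
  | size => simp [norm, eval, LogLin.eval]
  | lnN => simp [norm, eval, LogLin.eval]
  | nLnN => simp [norm, eval, LogLin.eval]
  | add e₁ e₂ h₁ h₂ => simp only [norm, eval, LogLin.eval_add, h₁, h₂]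
  | smul c e h => simp only [norm, eval, LogLin.eval_smul, h]

/-! ### Evaluation and differentiation of `ψ` -/

namespace Psi

theorem eval_cons (s : PsiTerm) (ψ : Psi) (c : ℝ) :
    Psi.eval (s :: ψ) c =
      s.μ * c ^ s.ν * (if s.withLog then Real.log c else 1) + Psi.eval ψ c := by
  simp [eval]

theorem eval_append (ψ χ : Psi) (c : ℝ) :
    Psi.eval (ψ ++ χ) c = Psi.eval ψ c + Psi.eval χ c := by
  simp [eval]

theorem eval_mulPow (ψ : Psi) (a : ℝ) {c : ℝ} (hc : 0 < c) :
    (ψ.mulPow a).eval c = ψ.eval c * c ^ a := by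
  induction ψ with
  | nil => simp [mulPow, eval]
  | cons s ψ ih =>
    have h : Psi.mulPow (s :: ψ) a = ⟨s.μ, s.ν + a, s.withLog⟩ :: Psi.mulPow ψ a := rfl
    rw [h, eval_cons, eval_cons, ih, Real.rpow_add hc]
    ring

theorem hasDerivAt_eval (ψ : Psi) {c : ℝ} (hc : 0 < c) :
    HasDerivAt ψ.eval (ψ.deriv.eval c) c := by
  induction ψ with
  | nil => exact hasDerivAt_const c (0 : ℝ)
  | cons s ψ ih =>
    have h : Psi.deriv (s :: ψ) = (⟨s.μ * s.ν, s.ν - 1, s.withLog⟩ ::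
        (if s.withLog then [⟨s.μ, s.ν - 1, false⟩] else [])) ++ Psi.deriv ψ := rfl
    have hfun : Psi.eval (s :: ψ) = fun c =>
        s.μ * c ^ s.ν * (if s.withLog then Real.log c else 1) + Psi.eval ψ c :=
      funext fun c => eval_cons s ψ c
    rw [h, eval_append, hfun]
    refine HasDerivAt.add ?_ ih
    have hp : HasDerivAt (fun c : ℝ => s.μ * c ^ s.ν) (s.μ * (s.ν * c ^ (s.ν - 1))) c :=
      (Real.hasDerivAt_rpow_const (Or.inl hc.ne')).const_mul _
    obtain ⟨μ, ν, b⟩ := s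
    cases b with
    | false =>
      simp only [eval, Bool.false_eq_true, if_false, List.map_cons, List.map_nil, List.sum_cons,
        List.sum_nil]
      exact (hp.mul_const 1).congr_deriv (by ring)
    | true =>
      simp only [eval, if_true, List.map_cons, List.map_nil, List.sum_cons, List.sum_nil,
        Bool.false_eq_true, if_false]
      refine (hp.mul (Real.hasDerivAt_log hc.ne')).congr_deriv ?_
      simp only [Real.rpow_sub_one hc.ne', div_eq_mul_inv]
      ring

end Psi

/-! ### Separability and the threshold `c*` -/

theorem ProvedSeparable.eval_one_nonneg {ψ : Psi} (h : ProvedSeparable ψ) : 0 ≤ ψ.eval 1 := by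
  induction h with
  | decreasing ψ h1 _ => exact h1
  | deriv ψ h1 _ _ => exact h1
  | divPow ψ a _ ih => simpa [Psi.eval_mulPow ψ (-a) one_pos] using ih

/-- On `[1, ∞)`, the sign of a separable function changes at most once, from `+` to `-`. -/
theorem ProvedSeparable.nonneg_of_le {ψ : Psi} (h : ProvedSeparable ψ) {x y : ℝ} (hx : 1 ≤ x)
    (hxy : x ≤ y) (hy : 0 ≤ ψ.eval y) : 0 ≤ ψ.eval x := by
  induction h generalizing x y with
  | decreasing ψ _ h => exact hy.trans (h.antitoneOn hx (hx.trans hxy) hxy)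
  | deriv ψ h1 _ ih =>
    by_contra! hneg
    have hx1 : 1 < x := lt_of_le_of_ne hx (by rintro rfl; exact hneg.not_ge h1)
    have hxy' : x < y := lt_of_le_of_ne hxy (by rintro rfl; exact hneg.not_ge hy)
    have hcont : ∀ z : ℝ, 1 ≤ z → ContinuousAt ψ.eval z := fun z hz =>
      (ψ.hasDerivAt_eval (by linarith)).continuousAt
    -- If `ψ` were negative at `x` but nonnegative at `1` and `y`, the mean value theorem would give
    -- `u < x < v` with `ψ' u < 0 ≤ ψ' v`, the sign pattern that separability of `ψ'` forbids.
    obtain ⟨u, hu, hu'⟩ := exists_hasDerivAt_eq_slope ψ.eval ψ.deriv.eval hx1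
      (fun z hz => (hcont z hz.1).continuousWithinAt)
      (fun z hz => ψ.hasDerivAt_eval (by linarith [hz.1]))
    obtain ⟨v, hv, hv'⟩ := exists_hasDerivAt_eq_slope ψ.eval ψ.deriv.eval hxy'
      (fun z hz => (hcont z (hx.trans hz.1)).continuousWithinAt)
      (fun z hz => ψ.hasDerivAt_eval (by linarith [hz.1]))
    have h1 : ψ.deriv.eval u < 0 := by
      rw [hu']; exact div_neg_of_neg_of_pos (by linarith) (by linarith)
    have h2 : 0 ≤ ψ.deriv.eval v := by
      rw [hv']; exact div_nonneg (by linarith) (by linarith)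
    exact h1.not_ge (ih hu.1.le (hu.2.trans hv.1).le h2)
  | divPow ψ a _ ih =>
    have hx0 : 0 < x := by linarith
    have hy0 : 0 < y := by linarith
    have := ih hx hxy (by rw [Psi.eval_mulPow ψ _ hy0]; positivity)
    rw [Psi.eval_mulPow ψ _ hx0] at this
    exact nonneg_of_mul_nonneg_left this (by positivity)

/-- Nonnegativity at the lower end is the loop invariant; the sign at the upper end plays no role.
-/
theorem eval_bisect_nonneg (ψ : Psi) (k : ℕ) (lo hi : ℝ) (h : 0 ≤ ψ.eval lo) :
    0 ≤ ψ.eval (bisect ψ lo hi k) := by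
  induction k generalizing lo hi with
  | zero => exact h
  | succ k ih =>
    rw [bisect]
    split_ifs with hm
    · exact ih _ _ hm
    · exact ih _ _ h

theorem Threshold.nonneg_of_le {ψ : Psi} {c : ℝ} (hc : Threshold ψ c) (h : ProvedSeparable ψ)
    {x : ℝ} (hx : 1 ≤ x) (hxc : x ≤ c) : 0 ≤ ψ.eval x := by
  cases hc with
  | exact c hc => exact (hc x hx).2 hxc
  | search hi hhi k => exact h.nonneg_of_le hx hxc (eval_bisect_nonneg ψ k 1 hi h.eval_one_nonneg)

/-! ### Symbolic inequalities -/

/-- The value of a term for given `α` and `n`, with `c = α ^ g(n)`. -/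
noncomputable def Term.value (g : LogLin) (α x : ℝ) (τ : Term) : ℝ :=
  τ.coeff.eval (α ^ g.eval x) * α ^ τ.exp.eval x

/-- The value of a sum of terms for given `α` and `n`, with `c = α ^ g(n)`. -/
noncomputable def listValue (g : LogLin) (α x : ℝ) (l : List Term) : ℝ :=
  (l.map (Term.value g α x)).sum

section

variable {g : LogLin} {N n : ℕ} {α : ℝ}

/-- Simplification may only decrease a term, so that nonnegativity of the simplified sum implies
that of the original. Since `g(n) > 0`, `c ≥ 1`, which is where the sign conditions on coefficients
are available. -/
theorem TermStep.value_le (hα : 1 < α) (hn : n ∈ sizes g N) {τ τ' : Term}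
    (h : TermStep g N τ τ') : τ'.value g α n ≤ τ.value g α n := by
  have hα0 : 0 < α := by linarith
  have hg := hn.2.2
  have hc : 1 ≤ α ^ g.eval n := Real.one_le_rpow hα.le hg.le
  have hc0 : 0 < α ^ g.eval n := by linarith
  cases h with
  | subst W E ω =>
    simp only [Term.value]
    rw [Psi.eval_mulPow W ω hc0, LogLin.eval_add, LogLin.eval_smul, Real.rpow_add hα0,
      mul_comm ω, Real.rpow_mul hα0.le]
    apply le_of_eq
    ring
  | dropPos W E e hW he =>
    simp only [Term.value]
    refine mul_le_mul_of_nonneg_left ?_ (hW _ hc)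
    rw [LogLin.eval_add]
    exact Real.rpow_le_rpow_of_exponent_le hα.le (by linarith [he n hn])
  | dropNeg W E e hW he =>
    simp only [Term.value]
    refine mul_le_mul_of_nonpos_left ?_ (hW _ hc)
    rw [LogLin.eval_add]
    exact Real.rpow_le_rpow_of_exponent_le hα.le (by linarith [he n hn])
  | round W E e hW he =>
    simp only [Term.value]
    rw [Psi.eval_mulPow W 1 hc0, Real.rpow_one, mul_assoc]
    refine mul_le_mul_of_nonpos_left ?_ (hW _ hc)
    rw [LogLin.eval_add, ← Real.rpow_add hα0]
    have := (div_le_one hg).1 (he n hn).2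
    exact Real.rpow_le_rpow_of_exponent_le hα.le (by linarith)

theorem Step.listValue_nonneg (hα : 1 < α) (hn : n ∈ sizes g N) {l l' : List Term}
    (h : Step g N l l') (h' : 0 ≤ listValue g α n l') : 0 ≤ listValue g α n l := by
  have hα0 : 0 < α := by linarith
  have hc : 1 ≤ α ^ g.eval n := Real.one_le_rpow hα.le hn.2.2.le
  cases h with
  | term l₁ l₂ τ τ' h =>
    have := h.value_le hα hn
    simp only [listValue, List.map_append, List.map_cons, List.sum_append, List.sum_cons] at h' ⊢
    linarith
  | zero l₁ l₂ τ h =>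
    simp only [listValue, List.map_append, List.map_cons, List.sum_append, List.sum_cons] at h' ⊢
    have h0 : τ.value g α n = 0 := by rw [Term.value, h _ hc, zero_mul]
    linarith
  | gcd l e =>
    have : listValue g α n (l'.map fun τ => ⟨τ.coeff, τ.exp + e⟩) =
        listValue g α n l' * α ^ e.eval n := by
      simp only [listValue, List.map_map, ← List.sum_map_mul_right]
      congr 1
      refine List.map_congr_left fun τ _ => ?_
      simp only [Function.comp, Term.value, LogLin.eval_add, Real.rpow_add hα0]
      ring
    rw [this]
    positivity

theorem listValue_nonneg_of_reduces (hα : 1 < α) (hn : n ∈ sizes g N) {l l' : List Term}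
    (h : Relation.ReflTransGen (Step g N) l l') (h' : 0 ≤ listValue g α n l') :
    0 ≤ listValue g α n l := by
  induction h with
  | refl => exact h'
  | tail _ h ih => exact ih (h.listValue_nonneg hα hn h')

theorem listValue_eq_eval {l : List Term} (h : ∀ τ ∈ l, τ.exp = 0) (x : ℝ) :
    listValue g α x l = Psi.eval (l.flatMap Term.coeff) (α ^ g.eval x) := by
  induction l with
  | nil => rfl
  | cons τ l ih =>
    rw [List.flatMap_cons, Psi.eval_append, ← ih fun σ hσ => h σ (List.mem_cons_of_mem _ hσ)]
    simp [listValue, Term.value, h τ, LogLin.eval_zero]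

end

/-! ### The exponent of the substitution -/

/-- Positivity gives `c ≥ 1` at every size `n ≥ 2`; monotonicity makes `N` the size with the largest
`c`. -/
theorem LogLin.leadMonomial_pos_and_mono (f : LogLin) :
    (∀ x : ℝ, 1 < x → 0 < f.leadMonomial.eval x) ∧
      MonotoneOn f.leadMonomial.eval (Set.Ici 1) := by
  unfold leadMonomial
  split_ifs
  · refine ⟨fun x hx => ?_, fun x hx y hy hxy => ?_⟩
    · have := Real.log_pos hx
      simp only [eval]; nlinarith
    · have hx' : (1 : ℝ) ≤ x := hx
      have h0 := Real.log_nonneg hx'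
      have := Real.log_le_log (by linarith) hxy
      simp only [eval]; nlinarith
  · refine ⟨fun x hx => ?_, fun x hx y hy hxy => ?_⟩
    · simp only [eval]; linarith
    · simp only [eval]; linarith
  · refine ⟨fun x hx => ?_, fun x hx y hy hxy => ?_⟩
    · have := Real.log_pos hx
      simp only [eval]; linarith
    · have hx' : (1 : ℝ) ≤ x := hx
      have := Real.log_le_log (by linarith) hxy
      simp only [eval]; linarith
  · refine ⟨fun x hx => ?_, fun x hx y hy hxy => ?_⟩ <;> simp [eval]

theorem Start.pos_and_mono {a : LogLin} {β γ : ℝ} {f g : LogLin} {e : List Term}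
    (h : Start a β γ f g e) :
    (∀ x : ℝ, 1 < x → 0 < g.eval x) ∧ MonotoneOn g.eval (Set.Ici 1) := by
  cases h with
  | linear =>
    refine ⟨fun x hx => ?_, fun x hx y hy hxy => ?_⟩ <;> simp only [LogLin.eval] <;> linarith
  | logarithmic => refine ⟨fun x hx => ?_, fun x hx y hy hxy => ?_⟩ <;> simp [LogLin.eval]
  | sampled => exact f.leadMonomial_pos_and_mono

/-- The inequality at the start of the simplification holds for the synthesised `α`. -/
theorem exists_start_nonneg {t : RecExpr} {f : GExpr} {N : ℕ} {g : LogLin} {ψ : Psi} {c α : ℝ}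
    (hψ : ReducesTo t f N g ψ) (hsep : ProvedSeparable ψ) (hc : Threshold ψ c)
    (hα : 1 < α) (hαc : α ^ g.eval N ≤ c) :
    ∃ e, Start t.cost t.fullWeight t.halfWeight f.norm g e ∧
      ∀ n : ℕ, 2 ≤ n → n ≤ N → 0 ≤ listValue g α n e := by
  obtain ⟨e₀, e₁, hs, hr, hz, rfl⟩ := hψ
  refine ⟨e₀, hs, fun n h2 hnN => ?_⟩
  obtain ⟨hpos, hmono⟩ := hs.pos_and_mono
  have h2' : (2 : ℝ) ≤ n := by exact_mod_cast h2
  have hnN' : (n : ℝ) ≤ N := by exact_mod_cast hnN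
  have hg : 0 < g.eval n := hpos n (by linarith)
  refine listValue_nonneg_of_reduces hα ⟨by omega, hnN, hg⟩ hr ?_
  rw [listValue_eq_eval hz]
  refine hc.nonneg_of_le hsep (Real.one_le_rpow hα.le hg.le) (le_trans ?_ hαc)
  exact Real.rpow_le_rpow_of_exponent_le hα.le
    (hmono (by simp only [Set.mem_Ici]; linarith) (by simp only [Set.mem_Ici]; linarith) hnN')

/-! ### The law of the runtime -/

namespace RecExpr

theorem IsSingleCall.callProb_nonneg {t : RecExpr} (ht : t.IsSingleCall) (n i : ℕ) :
    0 ≤ t.callProb n i := by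
  have := ht.full_nonneg
  have := ht.half_nonneg
  unfold callProb
  positivity

theorem sum_callProb_mul (t : RecExpr) (n : ℕ) (F : ℕ → ℝ) :
    ∑ i ∈ Finset.range n, t.callProb n i * F i =
      (t.fullWeight * ∑ i ∈ Finset.range n, F i + t.halfWeight *
        (∑ i ∈ Finset.Ico (n / 2) n, F i + ∑ i ∈ Finset.Ico ((n + 1) / 2) n, F i)) / n := by
  have key : ∀ m, ∑ i ∈ Finset.Ico m n, F i =
      ∑ i ∈ Finset.range n, (if m ≤ i then 1 else 0) * F i := by
    intro m
    simp only [ite_mul, one_mul, zero_mul]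
    rw [← Finset.sum_filter]
    congr 1
    ext i
    simp [and_comm]
  rw [key, key, ← Finset.sum_add_distrib, Finset.mul_sum, Finset.mul_sum,
    ← Finset.sum_add_distrib, Finset.sum_div]
  refine Finset.sum_congr rfl fun i _ => ?_
  unfold callProb
  ring

theorem IsSingleCall.sum_callProb {t : RecExpr} (ht : t.IsSingleCall) {n : ℕ} (hn : 0 < n) :
    ∑ i ∈ Finset.range n, t.callProb n i = 1 := by
  have h := t.sum_callProb_mul n fun _ => 1
  simp only [mul_one, Finset.sum_const, Finset.card_range, Nat.card_Ico, nsmul_eq_mul] at h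
  rw [h]
  -- The two half ranges have `⌈n/2⌉` and `⌊n/2⌋` elements, together `n`.
  have h1 : ((n - n / 2 : ℕ) : ℝ) + ((n - (n + 1) / 2 : ℕ) : ℝ) = n := by
    rw [← Nat.cast_add]; congr 1; omega
  have hn' : (n : ℝ) ≠ 0 := by positivity
  rw [h1, ← add_mul, ht.total, one_mul, div_self hn']

theorem law_zero (t : RecExpr) : t.law 0 = Measure.dirac 0 := by rw [law]

theorem law_one (t : RecExpr) : t.law 1 = Measure.dirac 0 := by rw [law]

theorem law_of_two_le (t : RecExpr) {n : ℕ} (hn : 2 ≤ n) :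
    t.law n = ∑ i ∈ Finset.range n, ENNReal.ofReal (t.callProb n i) •
      (t.law i).map (fun x => t.cost.eval n + x) := by
  obtain ⟨m, rfl⟩ := Nat.exists_eq_add_of_le' hn
  rw [law, Finset.sum_range]

theorem lintegral_law (t : RecExpr) {n : ℕ} (hn : 2 ≤ n) {φ : ℝ → ENNReal} (hφ : Measurable φ) :
    ∫⁻ x, φ x ∂t.law n = ∑ i ∈ Finset.range n, ENNReal.ofReal (t.callProb n i) *
      ∫⁻ x, φ (t.cost.eval n + x) ∂t.law i := by
  rw [t.law_of_two_le hn, lintegral_finsetSum_measure]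
  refine Finset.sum_congr rfl fun i _ => ?_
  rw [lintegral_smul_measure, lintegral_map hφ (by fun_prop), smul_eq_mul]

theorem IsSingleCall.isProbabilityMeasure_law {t : RecExpr} (ht : t.IsSingleCall) (n : ℕ) :
    IsProbabilityMeasure (t.law n) := by
  induction n using Nat.strong_induction_on with
  | _ n ih =>
    rcases Nat.lt_or_ge n 2 with h | h
    · interval_cases n
      · rw [law_zero]; infer_instance
      · rw [law_one]; infer_instance
    · constructor
      have h1 := t.lintegral_law h (φ := fun _ => 1) measurable_const
      rw [lintegral_one] at h1
      rw [h1, Finset.sum_congr rfl fun i hi => by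
        rw [lintegral_one, (ih i (Finset.mem_range.1 hi)).measure_univ, mul_one],
        ← ENNReal.ofReal_sum_of_nonneg fun i _ => ht.callProb_nonneg n i,
        ht.sum_callProb (by omega), ENNReal.ofReal_one]

/-- From size `2` the call reaches size `0` or `1`, both free, so `T(2)` is deterministic. This
turns the expectation hypothesis at `2` into `a(2) ≤ f(2)`. -/
theorem IsSingleCall.law_two {t : RecExpr} (ht : t.IsSingleCall) :
    t.law 2 = Measure.dirac (t.cost.eval 2) := by
  have h := ht.sum_callProb (n := 2) two_pos
  rw [t.law_of_two_le le_rfl]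
  rw [Finset.sum_range_succ, Finset.sum_range_one] at h ⊢
  rw [law_zero, law_one, Measure.map_dirac' (by fun_prop), ← add_smul,
    ← ENNReal.ofReal_add (ht.callProb_nonneg _ _) (ht.callProb_nonneg _ _), h]
  simp

/-- The exponential moment of `T(n)` is bounded by any solution of the recursive inequality. -/
theorem IsSingleCall.lintegral_rpow_le {t : RecExpr} (ht : t.IsSingleCall) {α : ℝ} (hα : 0 < α)
    {N : ℕ} {F : ℕ → ℝ} (hF : ∀ n, 0 ≤ F n) (h0 : 1 ≤ F 0) (h1 : 1 ≤ F 1)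
    (hrec : ∀ n, 2 ≤ n → n ≤ N →
      α ^ t.cost.eval n * ∑ i ∈ Finset.range n, t.callProb n i * F i ≤ F n)
    {n : ℕ} (hn : n ≤ N) :
    ∫⁻ x, ENNReal.ofReal (α ^ x) ∂t.law n ≤ ENNReal.ofReal (F n) := by
  have hm : Measurable fun x : ℝ => ENNReal.ofReal (α ^ x) := by fun_prop
  induction n using Nat.strong_induction_on with
  | _ n ih =>
    rcases Nat.lt_or_ge n 2 with h | h
    · interval_cases n
      · rw [law_zero, lintegral_dirac' _ hm, Real.rpow_zero]
        exact ENNReal.ofReal_le_ofReal h0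
      · rw [law_one, lintegral_dirac' _ hm, Real.rpow_zero]
        exact ENNReal.ofReal_le_ofReal h1
    · refine le_trans ?_ (ENNReal.ofReal_le_ofReal (hrec n h hn))
      rw [t.lintegral_law h hm, Finset.mul_sum, ENNReal.ofReal_sum_of_nonneg fun i _ =>
        mul_nonneg (by positivity) (mul_nonneg (ht.callProb_nonneg n i) (hF i))]
      refine Finset.sum_le_sum fun i hi => ?_
      rw [ENNReal.ofReal_mul (by positivity), ENNReal.ofReal_mul (ht.callProb_nonneg n i),
        mul_left_comm]
      gcongr
      have hi' := Finset.mem_range.1 hi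
      simp only [Real.rpow_add hα]
      simp_rw [ENNReal.ofReal_mul (Real.rpow_nonneg hα.le _)]
      rw [lintegral_const_mul _ hm]
      gcongr
      exact ih i hi' (by omega)

/-- Markov's inequality for `α ^ x`, which is increasing as `α > 1`. -/
theorem measure_ge_le_of_lintegral_rpow_le {μ : Measure ℝ} {α : ℝ} (hα : 1 < α) {u k : ℝ}
    (h : ∫⁻ x, ENNReal.ofReal (α ^ x) ∂μ ≤ ENNReal.ofReal (α ^ u)) :
    μ {x | k ≤ x} ≤ ENNReal.ofReal (α ^ (u - k)) := by
  have hα0 : 0 < α := by linarith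
  have hm : Measurable fun x : ℝ => ENNReal.ofReal (α ^ x) := by fun_prop
  have hk : 0 < α ^ k := by positivity
  have hset : {x | k ≤ x} ⊆ {x | ENNReal.ofReal (α ^ k) ≤ ENNReal.ofReal (α ^ x)} := fun x hx =>
    ENNReal.ofReal_le_ofReal (Real.rpow_le_rpow_of_exponent_le hα.le hx)
  refine (measure_mono hset).trans ?_
  refine (meas_ge_le_lintegral_div hm.aemeasurable (by simpa using hk)
    ENNReal.ofReal_ne_top).trans ?_
  rw [Real.rpow_sub hα0, ENNReal.ofReal_div_of_pos hk]
  gcongr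

end RecExpr

/-! ### Sums and integrals of monotone and convex functions -/

section Sums

open Set intervalIntegral

variable {G : ℝ → ℝ}

/-- A convex function lies below its chord, whose slope is `k` below. -/
theorem integral_le_trapezoid {a b : ℝ} (hab : a ≤ b) (hG : ConvexOn ℝ (Icc a b) G)
    (hi : IntervalIntegrable G volume a b) : ∫ x in a..b, G x ≤ (b - a) * (G a + G b) / 2 := by
  rcases hab.eq_or_lt with rfl | hlt
  · simp
  have hba : 0 < b - a := sub_pos.2 hlt
  set k := (G b - G a) / (b - a) with hk
  have hint : ∫ x in a..b, (G a - k * a + k * x) = (b - a) * (G a + G b) / 2 := by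
    rw [integral_add (by simp) (Continuous.intervalIntegrable (by fun_prop) _ _),
      intervalIntegral.integral_const_mul, integral_id, intervalIntegral.integral_const, smul_eq_mul, hk]
    field_simp
    ring
  rw [← hint]
  refine integral_mono_on hab hi (Continuous.intervalIntegrable (by fun_prop) _ _) fun x hx => ?_
  have h := hG.2 (left_mem_Icc.2 hab) (right_mem_Icc.2 hab)
    (div_nonneg (sub_nonneg.2 hx.2) hba.le) (div_nonneg (sub_nonneg.2 hx.1) hba.le)
    (by field_simp; ring)
  simp only [smul_eq_mul] at h
  have hx' : (b - x) / (b - a) * a + (x - a) / (b - a) * b = x := by field_simp; ring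
  rw [hx'] at h
  refine h.trans (le_of_eq ?_)
  rw [hk]
  field_simp
  ring

/-- Summing unit trapezoids gives the left sum plus half the boundary difference. Applied to `-G`,
it yields the gain over left sums for concave `G`. -/
theorem integral_le_sum_trapezoid {a b : ℕ} (hab : a ≤ b) (hG : ConvexOn ℝ (Icc (a : ℝ) b) G)
    (hc : ContinuousOn G (Icc (a : ℝ) b)) :
    ∫ x in a..b, G x ≤ ∑ i ∈ Finset.Ico a b, G i + (G b - G a) / 2 := by
  induction b, hab using Nat.le_induction with
  | base => simp
  | succ b hab ih =>
    have hab' : (a : ℝ) ≤ b := by exact_mod_cast hab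
    have hs : Icc (a : ℝ) b ⊆ Icc (a : ℝ) (b + 1 : ℕ) := Icc_subset_Icc_right (by push_cast; linarith)
    have hs' : Icc (b : ℝ) (b + 1 : ℕ) ⊆ Icc (a : ℝ) (b + 1 : ℕ) := Icc_subset_Icc_left hab'
    have hi : IntervalIntegrable G volume a b :=
      (hc.mono hs).intervalIntegrable_of_Icc hab'
    have hi' : IntervalIntegrable G volume b (b + 1 : ℕ) :=
      (hc.mono hs').intervalIntegrable_of_Icc (by push_cast; linarith)
    have h1 := ih (hG.subset hs (convex_Icc _ _)) (hc.mono hs)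
    have h2 := integral_le_trapezoid (by push_cast; linarith)
      (hG.subset hs' (convex_Icc _ _)) hi'
    rw [← integral_add_adjacent_intervals hi hi', Finset.sum_Ico_succ_top hab]
    push_cast at h2 ⊢
    linarith

/-- Pair `x` with `2 - x` and use convexity at their midpoint `1`. -/
theorem two_mul_midpoint_le_integral (hG : ConvexOn ℝ (Icc 0 2) G)
    (hi : IntervalIntegrable G volume 0 2) : 2 * G 1 ≤ ∫ x in (0 : ℝ)..2, G x := by
  have hr : ∫ x in (0 : ℝ)..2, G (2 - x) = ∫ x in (0 : ℝ)..2, G x := by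
    rw [integral_comp_sub_left]; norm_num
  have hi' : IntervalIntegrable (fun x => G (2 - x)) volume 0 2 := by
    simpa using (hi.comp_sub_left 2).symm
  have h : ∫ _ in (0 : ℝ)..2, 2 * G 1 ≤ ∫ x in (0 : ℝ)..2, (G x + G (2 - x)) := by
    refine integral_mono_on zero_le_two (by simp) (hi.add hi') fun x hx => ?_
    have := hG.2 hx (show 2 - x ∈ Icc (0 : ℝ) 2 from ⟨by linarith [hx.2], by linarith [hx.1]⟩)
      (by norm_num : (0 : ℝ) ≤ 1 / 2) (by norm_num : (0 : ℝ) ≤ 1 / 2) (by norm_num)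
    simp only [smul_eq_mul] at this
    rw [show 1 / 2 * x + 1 / 2 * (2 - x) = (1 : ℝ) by ring] at this
    linarith
  rw [integral_add hi hi', hr, intervalIntegral.integral_const, smul_eq_mul] at h
  linarith

/-- Left-hand sum over all sizes, for a convex function that need not be monotone on `[0, 1]`. -/
theorem sum_range_le_integral (hG : ConvexOn ℝ (Ici 0) G) (hc : ContinuousOn G (Ici 0))
    (hm : MonotoneOn G (Ici 1)) (h01 : G 0 ≤ G 1) {n : ℕ} (hn : 2 ≤ n) :
    ∑ i ∈ Finset.range n, G i ≤ ∫ x in (0 : ℝ)..n, G x := by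
  have hn' : (2 : ℝ) ≤ n := by exact_mod_cast hn
  have hi : IntervalIntegrable G volume 0 2 :=
    (hc.mono Icc_subset_Ici_self).intervalIntegrable_of_Icc zero_le_two
  have hi' : IntervalIntegrable G volume 2 n :=
    (hc.mono fun x hx => zero_le_two.trans hx.1).intervalIntegrable_of_Icc hn'
  -- Sizes `0` and `1` are treated together: `G 0 + G 1 ≤ 2 * G 1 ≤ ∫₀²`. From `2` on, monotonicity
  -- suffices.
  have h1 := two_mul_midpoint_le_integral (hG.subset Icc_subset_Ici_self (convex_Icc _ _)) hi
  have h2 : ∑ i ∈ Finset.Ico 2 n, G i ≤ ∫ x in ((2 : ℕ) : ℝ)..n, G x :=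
    MonotoneOn.sum_le_integral_Ico hn (hm.mono fun x hx => by
      have : ((2 : ℕ) : ℝ) ≤ x := hx.1
      simp only [mem_Ici]; push_cast at this; linarith)
  rw [← integral_add_adjacent_intervals hi hi', ← Finset.sum_range_add_sum_Ico _ hn,
    Finset.sum_range_succ, Finset.sum_range_one]
  push_cast at h2 ⊢
  linarith

/-- Right-hand sum for a convex function. -/
theorem integral_le_riemann_of_convexOn (hG : ConvexOn ℝ (Ici 0) G) (hc : ContinuousOn G (Ici 0))
    {v : ℝ} (hv : 0 < v) (h0 : G 0 ≤ G v) {B : ℕ} (hB : 0 < B) :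
    ∫ x in (0 : ℝ)..v, G x ≤ v / B * ∑ j ∈ Finset.range B, G (v * ((j + 1) / B)) := by
  have hB' : (0 : ℝ) < B := by exact_mod_cast hB
  have hpos : 0 < v / B := by positivity
  have hmaps : ∀ x ∈ Icc ((0 : ℕ) : ℝ) (B : ℕ), v / B * x ∈ Ici (0 : ℝ) := fun x hx => by
    have : (0 : ℝ) ≤ x := by simpa using hx.1
    exact mul_nonneg hpos.le this
  have hconv : ConvexOn ℝ (Icc ((0 : ℕ) : ℝ) (B : ℕ)) fun x => G (v / B * x) := by
    refine ⟨convex_Icc _ _, fun x hx y hy p q hp hq hpq => ?_⟩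
    have := hG.2 (hmaps x hx) (hmaps y hy) hp hq hpq
    simp only [smul_eq_mul] at this ⊢
    rwa [show v / B * (p * x + q * y) = p * (v / B * x) + q * (v / B * y) by ring]
  have h := integral_le_sum_trapezoid (Nat.zero_le B) hconv
    (hc.comp (by fun_prop) hmaps)
  have hBv : v / B * B = v := by field_simp
  have hsub : v / B * ∫ x in (0 : ℝ)..B, G (v / B * x) = ∫ x in (0 : ℝ)..v, G x := by
    rw [mul_integral_comp_mul_left, hBv, mul_zero]
  rw [← hsub]
  refine mul_le_mul_of_nonneg_left ?_ hpos.le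
  -- The right sum exceeds the left one by `G v - G 0 ≥ 0`, while the trapezoidal sum adds only half
  -- of this.
  have hshift : ∑ j ∈ Finset.range B, G (v * ((j + 1) / B)) + G 0 =
      ∑ j ∈ Finset.range B, G (v / B * j) + G v := by
    have h1 := Finset.sum_range_succ (fun j : ℕ => G (v / B * j)) B
    rw [Finset.sum_range_succ'] at h1
    rw [hBv] at h1
    rw [← h1]
    simp only [Nat.cast_zero, mul_zero, Nat.cast_add, Nat.cast_one]
    congr 1
    exact Finset.sum_congr rfl fun j _ => by congr 1; ring
  simp only [Nat.Ico_zero_eq_range, Nat.cast_zero, mul_zero, hBv] at h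
  linarith

/-- Right-hand sum for a monotone function. -/
theorem integral_le_riemann_of_monotoneOn {u v : ℝ} (huv : u ≤ v) (hm : MonotoneOn G (Icc u v))
    {B : ℕ} (hB : 0 < B) :
    ∫ x in u..v, G x ≤
      (v - u) / B * ∑ j ∈ Finset.range B, G (u + (v - u) * ((j + 1) / B)) := by
  have hB' : (0 : ℝ) < B := by exact_mod_cast hB
  have hpos : 0 ≤ (v - u) / B := div_nonneg (sub_nonneg.2 huv) hB'.le
  have hBv : u + (v - u) / B * B = v := by field_simp; ring
  have hmono : MonotoneOn (fun x => G (u + (v - u) / B * x)) (Icc 0 (0 + B)) := by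
    have hmaps : ∀ x ∈ Icc (0 : ℝ) (0 + B), u + (v - u) / B * x ∈ Icc u v := fun x hx => by
      have h1 := mul_nonneg hpos hx.1
      have h2 := mul_le_mul_of_nonneg_left hx.2 hpos
      rw [zero_add] at h2
      exact ⟨by linarith, by linarith⟩
    intro x hx y hy hxy
    refine hm (hmaps x hx) (hmaps y hy) ?_
    have := mul_le_mul_of_nonneg_left hxy hpos
    linarith
  have h := hmono.integral_le_sum
  have hsub : (v - u) / B * ∫ x in (0 : ℝ)..B, G (u + (v - u) / B * x) = ∫ x in u..v, G x := by
    rw [mul_integral_comp_add_mul, hBv, mul_zero, add_zero]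
  rw [← hsub]
  refine mul_le_mul_of_nonneg_left ?_ hpos
  rw [zero_add] at h
  refine h.trans (le_of_eq (Finset.sum_congr rfl fun j _ => ?_))
  push_cast
  congr 1
  ring

theorem intervalIntegrable_of_monotoneOn_Ici_one (hm : MonotoneOn G (Ici 1)) {a b : ℝ}
    (ha : 1 ≤ a) (hb : 1 ≤ b) : IntervalIntegrable G volume a b :=
  (hm.mono fun _ hx => (le_min ha hb).trans hx.1).intervalIntegrable

/-- The two sums over the upper half of the sizes. -/
theorem sum_halves_le_integral (hm : MonotoneOn G (Ici 1)) {n : ℕ} (hn : 2 ≤ n) :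
    ∑ i ∈ Finset.Ico (n / 2) n, G i + ∑ i ∈ Finset.Ico ((n + 1) / 2) n, G i ≤
      2 * ∫ x in (n : ℝ) / 2..n, G x := by
  have hsum : ∀ m : ℕ, 1 ≤ m → m ≤ n → ∑ i ∈ Finset.Ico m n, G i ≤ ∫ x in (m : ℝ)..n, G x :=
    fun m h1 hmn => MonotoneOn.sum_le_integral_Ico hmn (hm.mono fun x hx =>
      le_trans (by exact_mod_cast h1) hx.1)
  obtain ⟨m, rfl | rfl⟩ := Nat.even_or_odd' n
  · have h := hsum m (by omega) (by omega)
    rw [show 2 * m / 2 = m by omega, show (2 * m + 1) / 2 = m by omega,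
      show ((2 * m : ℕ) : ℝ) / 2 = m by push_cast; ring]
    linarith
  · have hm1 : (1 : ℝ) ≤ m := by exact_mod_cast (by omega : 1 ≤ m)
    have h := hsum (m + 1) (by omega) (by omega)
    rw [show (2 * m + 1) / 2 = m by omega, show (2 * m + 1 + 1) / 2 = m + 1 by omega,
      Finset.sum_eq_sum_Ico_succ_bot (by omega)]
    have hhalf : ((2 * m + 1 : ℕ) : ℝ) / 2 ≤ (m + 1 : ℕ) := by push_cast; linarith
    have hhalf1 : (1 : ℝ) ≤ ((2 * m + 1 : ℕ) : ℝ) / 2 := by push_cast; linarith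
    have hi := intervalIntegrable_of_monotoneOn_Ici_one hm hhalf1 (b := (m + 1 : ℕ))
      (by push_cast; linarith)
    have hi' := intervalIntegrable_of_monotoneOn_Ici_one hm (a := (m + 1 : ℕ))
      (b := (2 * m + 1 : ℕ)) (by push_cast; linarith) (by push_cast; linarith)
    -- For odd `n = 2m + 1`, the extra term `G m` is paid for by twice the integral over `[n/2, m +
    -- 1]`, of length `1/2`.
    have h2 : ∫ _ in ((2 * m + 1 : ℕ) : ℝ) / 2..(m + 1 : ℕ), G m ≤
        ∫ x in ((2 * m + 1 : ℕ) : ℝ) / 2..(m + 1 : ℕ), G x := by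
      refine integral_mono_on hhalf (by simp) hi fun x hx => ?_
      have hx1 := hx.1
      push_cast at hx1
      exact hm hm1 (by simp only [mem_Ici]; linarith) (by linarith)
    rw [intervalIntegral.integral_const, smul_eq_mul] at h2
    rw [← integral_add_adjacent_intervals hi hi']
    push_cast at h h2 ⊢
    linarith

/-- For concave functions the two sums over the upper half leave a gap to the integral. -/
theorem sum_halves_add_le_integral (hm : MonotoneOn G (Ici 1)) (hG : ConcaveOn ℝ (Ici 1) G)
    (hc : ContinuousOn G (Ici 1)) {n : ℕ} (hn : 2 ≤ n) :
    ∑ i ∈ Finset.Ico (n / 2) n, G i + ∑ i ∈ Finset.Ico ((n + 1) / 2) n, G i + (G n - G (n / 2)) ≤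
      2 * ∫ x in (n : ℝ) / 2..n, G x := by
  have hsum : ∀ m : ℕ, 1 ≤ m → m ≤ n →
      ∑ i ∈ Finset.Ico m n, G i + (G n - G m) / 2 ≤ ∫ x in (m : ℝ)..n, G x := by
    intro m h1 hmn
    have hs : Icc (m : ℝ) n ⊆ Ici 1 := fun x hx => le_trans (by exact_mod_cast h1) hx.1
    have h := integral_le_sum_trapezoid (G := -G) hmn (hG.neg.subset hs (convex_Icc _ _))
      (hc.mono hs).neg
    simp only [Pi.neg_apply, intervalIntegral.integral_neg, Finset.sum_neg_distrib] at h
    linarith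
  obtain ⟨m, rfl | rfl⟩ := Nat.even_or_odd' n
  · have h := hsum m (by omega) (by omega)
    rw [show 2 * m / 2 = m by omega, show (2 * m + 1) / 2 = m by omega,
      show ((2 * m : ℕ) : ℝ) / 2 = m by push_cast; ring]
    linarith
  · have hm1 : (1 : ℝ) ≤ m := by exact_mod_cast (by omega : 1 ≤ m)
    have h := hsum (m + 1) (by omega) (by omega)
    rw [show (2 * m + 1) / 2 = m by omega, show (2 * m + 1 + 1) / 2 = m + 1 by omega,
      Finset.sum_eq_sum_Ico_succ_bot (by omega)]
    set u : ℝ := ((2 * m + 1 : ℕ) : ℝ) / 2 with hu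
    have hu' : u = m + 1 / 2 := by rw [hu]; push_cast; ring
    have hhalf : u ≤ (m + 1 : ℕ) := by push_cast; linarith
    have hu1 : 1 ≤ u := by linarith
    have hs : Icc u (m + 1 : ℕ) ⊆ Ici 1 := fun x hx => hu1.trans hx.1
    have hi := intervalIntegrable_of_monotoneOn_Ici_one hm hu1 (b := (m + 1 : ℕ))
      (by push_cast; linarith)
    have hi' := intervalIntegrable_of_monotoneOn_Ici_one hm (a := (m + 1 : ℕ))
      (b := (2 * m + 1 : ℕ)) (by push_cast; linarith) (by push_cast; linarith)
    have h2 := integral_le_trapezoid (G := -G) hhalf (hG.neg.subset hs (convex_Icc _ _)) hi.neg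
    simp only [Pi.neg_apply, intervalIntegral.integral_neg] at h2
    -- After the trapezoid bounds the odd case requires `G m + G (m + 1) / 2 ≤ 3/2 * G u`: half of
    -- `G m ≤ G u` plus midpoint concavity at `u = m + 1/2`.
    have hmu : G m ≤ G u := hm hm1 hu1 (by linarith)
    have hmid := hG.2 (x := (m : ℝ)) hm1 (y := ((m + 1 : ℕ) : ℝ))
      (by simp only [mem_Ici]; push_cast; linarith)
      (by norm_num : (0 : ℝ) ≤ 1 / 2) (by norm_num : (0 : ℝ) ≤ 1 / 2) (by norm_num)
    simp only [smul_eq_mul] at hmid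
    rw [show 1 / 2 * (m : ℝ) + 1 / 2 * ((m + 1 : ℕ) : ℝ) = u by rw [hu']; push_cast; ring] at hmid
    rw [← integral_add_adjacent_intervals hi hi']
    have h3 : ((m + 1 : ℕ) : ℝ) - u = 1 / 2 := by rw [hu']; push_cast; ring
    rw [h3] at h2
    linarith

end Sums

/-! ### The logarithmic case -/

section Log

variable {s : ℝ}

theorem monotoneOn_rpow_Ici_one (hs : 0 ≤ s) : MonotoneOn (fun x : ℝ => x ^ s) (Set.Ici 1) :=
  fun _ hx _ _ hxy => Real.rpow_le_rpow (zero_le_one.trans hx) hxy hs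

theorem half_rpow (n : ℕ) (s : ℝ) : ((n : ℝ) / 2) ^ s = (n : ℝ) ^ s * 2 ^ (-s) := by
  rw [Real.div_rpow n.cast_nonneg zero_le_two, Real.rpow_neg zero_le_two, div_eq_mul_inv]

theorem integral_half_rpow (hs : 0 ≤ s) {n : ℕ} (hn : 0 < n) :
    2 * ∫ x in (n : ℝ) / 2..n, x ^ s = n * (n : ℝ) ^ s * (2 - 2 ^ (-s)) / (s + 1) := by
  have hn' : (0 : ℝ) < n := by exact_mod_cast hn
  rw [integral_rpow (Or.inl (by linarith)), Real.rpow_add_one hn'.ne',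
    Real.rpow_add_one (by positivity), half_rpow n s]
  field_simp

theorem sum_Ico_two_rpow_le (hs : 0 ≤ s) {n : ℕ} (hn : 2 ≤ n) :
    ∑ i ∈ Finset.Ico 2 n, (i : ℝ) ^ s ≤ (n * (n : ℝ) ^ s - 2 * 2 ^ s) / (s + 1) := by
  have h := MonotoneOn.sum_le_integral_Ico (f := fun x : ℝ => x ^ s) hn
    ((monotoneOn_rpow_Ici_one hs).mono fun x hx => le_trans (by norm_num) hx.1)
  rw [integral_rpow (Or.inl (by linarith)), Nat.cast_ofNat,
    Real.rpow_add_one (by positivity), Real.rpow_add_one two_ne_zero] at h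
  refine h.trans (le_of_eq ?_)
  ring

/-- For `s ≤ 1` the power is concave, and the trapezoid gain is kept: it later pays for sizes `0`
and `1`. -/
theorem sum_Ico_two_rpow_add_le (hs : 0 ≤ s) (hs1 : s ≤ 1) {n : ℕ} (hn : 2 ≤ n) :
    ∑ i ∈ Finset.Ico 2 n, (i : ℝ) ^ s + ((n : ℝ) ^ s - 2 ^ s) / 2 ≤
      (n * (n : ℝ) ^ s - 2 * 2 ^ s) / (s + 1) := by
  have hsub : Set.Icc ((2 : ℕ) : ℝ) n ⊆ Set.Ici 0 := fun x hx => le_trans (by norm_num) hx.1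
  have h := integral_le_sum_trapezoid (G := -fun x : ℝ => x ^ s) hn
    ((Real.concaveOn_rpow hs hs1).neg.subset hsub (convex_Icc _ _))
    (Real.continuous_rpow_const hs).continuousOn.neg
  simp only [Pi.neg_apply, intervalIntegral.integral_neg, Finset.sum_neg_distrib] at h
  rw [integral_rpow (Or.inl (by linarith)), Nat.cast_ofNat,
    Real.rpow_add_one (by positivity), Real.rpow_add_one two_ne_zero] at h
  have : ((n : ℝ) ^ s * n - 2 ^ s * 2) / (s + 1) = (n * (n : ℝ) ^ s - 2 * 2 ^ s) / (s + 1) := by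
    ring
  linarith

/-- The right-hand side of the recurrence, for a function `F` of the input size. -/
noncomputable def recSum (β γ : ℝ) (F : ℕ → ℝ) (n : ℕ) : ℝ :=
  β * ∑ i ∈ Finset.range n, F i +
    γ * (∑ i ∈ Finset.Ico (n / 2) n, F i + ∑ i ∈ Finset.Ico ((n + 1) / 2) n, F i)

variable {β γ A D : ℝ}

/-- For `s ≥ 1` the function `D * n ^ s` itself works, with value `D` at size `0`, matching `ln 0 =
0`. -/
theorem exists_majorant_of_one_le (hβ : 0 ≤ β) (hγ : 0 ≤ γ) (hA : 0 < A) (hD : 1 ≤ D)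
    (hs : 1 ≤ s) (h : A * (β + γ * (2 - 2 ^ (-s))) ≤ s + 1) :
    ∃ F : ℕ → ℝ, (∀ n, 0 ≤ F n) ∧ 1 ≤ F 0 ∧ 1 ≤ F 1 ∧ (∀ n, 1 ≤ n → F n ≤ D * (n : ℝ) ^ s) ∧
      ∀ n, 2 ≤ n → A * recSum β γ F n ≤ n * F n := by
  have hs0 : 0 ≤ s := by linarith
  have hD0 : 0 ≤ D := by linarith
  have hF : ∀ i : ℕ, 1 ≤ i → max i 1 = i := fun i hi => max_eq_left hi
  refine ⟨fun i => D * ((max i 1 : ℕ) : ℝ) ^ s, fun n => by positivity, by simpa using hD,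
    by simpa using hD, fun n hn => by simp only [hF n hn]; exact le_rfl, fun n hn => ?_⟩
  have hn0 : 0 < n := by omega
  have hsum : ∀ m, 1 ≤ m → ∑ i ∈ Finset.Ico m n, D * ((max i 1 : ℕ) : ℝ) ^ s =
      D * ∑ i ∈ Finset.Ico m n, (i : ℝ) ^ s := fun m hm => by
    rw [Finset.mul_sum]
    refine Finset.sum_congr rfl fun i hi => ?_
    rw [hF i (hm.trans (Finset.mem_Ico.1 hi).1)]
  -- Bernoulli bounds the contribution `2 * D` of sizes `0` and `1` by `D * ∫₀² x ^ s = D * 2 * 2 ^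
  -- s / (s + 1)`; this needs `s ≥ 1`.
  have hbern : s + 1 ≤ 2 ^ s := by
    have := one_add_mul_self_le_rpow_one_add (s := 1) (by norm_num) hs
    norm_num at this
    linarith
  have hfull := sum_Ico_two_rpow_le hs0 hn
  have hhalf := sum_halves_le_integral (monotoneOn_rpow_Ici_one hs0) hn
  rw [integral_half_rpow hs0 hn0] at hhalf
  simp only [recSum, hF n (by omega)]
  rw [hsum _ (by omega), hsum _ (by omega), ← Finset.sum_range_add_sum_Ico _ hn, hsum _ (by omega),
    Finset.sum_range_succ, Finset.sum_range_one]
  simp only [zero_le, sup_of_le_right, Nat.cast_one, Real.one_rpow, max_self, ← mul_add]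
  set Q := (n : ℝ) * (n : ℝ) ^ s with hQ
  have hQ0 : 0 ≤ Q := by positivity
  have h1 : D * 1 + D * 1 + D * ∑ i ∈ Finset.Ico 2 n, (i : ℝ) ^ s ≤ D * (Q / (s + 1)) := by
    have h2 : 2 ≤ 2 * 2 ^ s / (s + 1) := by rw [le_div_iff₀ (by linarith)]; linarith
    rw [sub_div] at hfull
    have := mul_le_mul_of_nonneg_left hfull hD0
    have := mul_le_mul_of_nonneg_left h2 hD0
    linarith
  have h2 := mul_le_mul_of_nonneg_left hhalf hD0
  have h3 := add_le_add (mul_le_mul_of_nonneg_left h1 hβ) (mul_le_mul_of_nonneg_left h2 hγ)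
  have h4 := mul_le_mul_of_nonneg_left h3 hA.le
  rw [← mul_add] at h1
  have h5 : A * (β * (D * (Q / (s + 1))) + γ * (D * (Q * (2 - 2 ^ (-s)) / (s + 1)))) =
      D * Q / (s + 1) * (A * (β + γ * (2 - 2 ^ (-s)))) := by ring
  have h6 : D * Q / (s + 1) * (A * (β + γ * (2 - 2 ^ (-s)))) ≤ D * Q / (s + 1) * (s + 1) :=
    mul_le_mul_of_nonneg_left h (by positivity)
  have h7 : D * Q / (s + 1) * (s + 1) = n * (D * (n : ℝ) ^ s) := by
    rw [hQ]; field_simp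
  rw [h5] at h4
  simp only [← mul_add] at h4 ⊢
  linarith

/-- By convexity of `exp`, `2 ^ (-s)` lies below its chord on `[0, 1]`. -/
theorem half_le_one_sub_two_rpow_neg (hs0 : 0 ≤ s) (hs1 : s ≤ 1) : s / 2 ≤ 1 - (2 : ℝ) ^ (-s) := by
  have := convexOn_exp.2 (Set.mem_univ 0) (Set.mem_univ (-Real.log 2)) (sub_nonneg.2 hs1) hs0
    (by ring)
  simp only [smul_eq_mul, Real.exp_zero, Real.exp_neg, Real.exp_log zero_lt_two] at this
  rw [Real.rpow_def_of_pos zero_lt_two]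
  have h2 : (1 - s) * 0 + s * -Real.log 2 = Real.log 2 * -s := by ring
  rw [h2] at this
  linarith

/-- `(3/2) ^ s ≥ 1 + s * ln (3/2)`, and `ln (1 + x) ≥ 2x / (x + 2)` at `x = 1/2` gives the constant
`2/5`. -/
theorem rpow_three_bound (hs0 : 0 ≤ s) : 1 + 2 / 5 * s ≤ (3 : ℝ) ^ s * 2 ^ (-s) := by
  have h1 : (2 : ℝ) / 5 ≤ Real.log (3 / 2) := by
    have := Real.le_log_one_add_of_nonneg (x := 1 / 2) (by norm_num)
    norm_num at this
    exact this
  have h2 : (3 : ℝ) ^ s * 2 ^ (-s) = Real.exp (Real.log (3 / 2) * s) := by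
    rw [Real.rpow_neg zero_le_two, ← div_eq_mul_inv, ← Real.div_rpow (by norm_num) (by norm_num),
      Real.rpow_def_of_pos (by norm_num)]
  rw [h2]
  have := Real.add_one_le_exp (Real.log (3 / 2) * s)
  have := mul_le_mul_of_nonneg_right h1 hs0
  linarith

/-- The inequality at size `3`. -/
theorem recSum_three_le (hγ : 0 ≤ γ) (hsum : β + γ = 1) (hs0 : 0 ≤ s) (hs1 : s ≤ 1)
    (h : A * (1 + γ * (1 - 2 ^ (-s))) ≤ s + 1) :
    β * (2 + A) + γ * (1 + 2 * A) ≤ 3 * ((3 : ℝ) ^ s * 2 ^ (-s)) := by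
  have hw := half_le_one_sub_two_rpow_neg hs0 hs1
  have h3 := rpow_three_bound hs0
  set w := 1 - (2 : ℝ) ^ (-s)
  have hβ : β = 1 - γ := by linarith
  have hden : 0 < 1 + γ * w := by nlinarith
  -- With `β = 1 - γ` the left side of the goal is `2 - γ + (1 + γ) * A`, and the right side is at
  -- least `3 + 6/5 * s`.
  have hkey : (1 + γ) * A ≤ 1 + γ + 6 / 5 * s := by
    have h4 : (1 + γ) * (s + 1) ≤ (1 + γ + 6 / 5 * s) * (1 + γ * w) := by
      have h5 : γ * (s / 2) ≤ γ * w := mul_le_mul_of_nonneg_left hw hγ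
      have h6 : (1 + γ) * (γ * (s / 2)) ≤ (1 + γ + 6 / 5 * s) * (γ * w) := by
        apply mul_le_mul (by linarith) h5 (by positivity) (by positivity)
      -- The quadratic is at least `1/5 - 1/8`, so the constant `2/5` above is good enough.
      have h7 : 0 ≤ s * (γ ^ 2 / 2 - γ / 2 + 1 / 5) :=
        mul_nonneg hs0 (by nlinarith [sq_nonneg (γ - 1 / 2)])
      nlinarith
    have h8 : ((1 + γ) * A) * (1 + γ * w) ≤ (1 + γ + 6 / 5 * s) * (1 + γ * w) := by
      have := mul_le_mul_of_nonneg_left h (by linarith : 0 ≤ 1 + γ)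
      linarith
    exact le_of_mul_le_mul_right h8 hden
  rw [hβ]
  linarith

/-- The arithmetic of the inequality at sizes `n ≥ 4`; `y` stands for `(n / 2) ^ s`. -/
theorem recSum_arith {n p X₁ X₂ y : ℝ} (hβ : 0 ≤ β) (hγ : 0 ≤ γ) (hsum : β + γ = 1) (hs : 0 ≤ s)
    (hp0 : 0 < p) (hp1 : p ≤ 1) (hX₁0 : 0 ≤ X₁) (hX₂0 : 0 ≤ X₂)
    (hA : A * (1 + γ * (1 - p)) ≤ s + 1) (hy : 1 ≤ y * p)
    (hX₁ : X₁ + (y - 1) / 2 ≤ (n * y - 2) / (s + 1))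
    (hX₂ : X₂ + y * (1 - p) ≤ n * y * (2 - p) / (s + 1)) :
    β * (2 + A * X₁) + γ * (A * X₂) ≤ n * y := by
  have hs1 : 0 < s + 1 := by linarith
  have hw : 0 ≤ 1 - p := by linarith
  have hden : 0 < 1 + γ * (1 - p) := by positivity
  rw [le_div_iff₀ hs1] at hX₁ hX₂
  have hy1 : 1 ≤ y := by nlinarith
  -- `y ≥ 1/p` and `1/p + p ≥ 2`.
  have hyw : 1 - p ≤ y - 1 := by nlinarith [sq_nonneg (1 - p)]
  have h1 : (A * (1 + γ * (1 - p))) * (β * X₁ + γ * X₂) ≤ (s + 1) * (β * X₁ + γ * X₂) :=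
    mul_le_mul_of_nonneg_right hA (by positivity)
  have h2 := mul_le_mul_of_nonneg_left hX₁ hβ
  have h3 := mul_le_mul_of_nonneg_left hX₂ hγ
  have h4 : 2 * β * γ ≤ β / 2 + γ := by nlinarith [sq_nonneg (β - γ)]
  -- Multiplied by `1 + γ * (1 - p)`, the cost `2β` of sizes `0` and `1` exceeds the `2β` saved by
  -- integrating from `2` by exactly this left side; the concavity gains on the right absorb it.
  have h5 : (1 - p) * (2 * β * γ) ≤ β * ((y - 1) / 2) + γ * (y * (1 - p)) := by
    have h6 := mul_le_mul_of_nonneg_left h4 hw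
    have h7 := mul_le_mul_of_nonneg_left hyw hβ
    have h8 := mul_le_mul_of_nonneg_left (mul_le_mul_of_nonneg_right hy1 hw) hγ
    linarith
  have h6 : β * ((y - 1) / 2) + γ * (y * (1 - p)) ≤
      (β * ((y - 1) / 2) + γ * (y * (1 - p))) * (s + 1) :=
    le_mul_of_one_le_right (add_nonneg (mul_nonneg hβ (by linarith)) (by positivity)) (by linarith)
  have h7 : (β * (2 + A * X₁) + γ * (A * X₂)) * (1 + γ * (1 - p)) ≤
      n * y * (1 + γ * (1 - p)) := by
    have h8 : β * (n * y - 2) + γ * (n * y * (2 - p)) =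
        n * y * (1 + γ * (1 - p)) - 2 * β := by
      have : β = 1 - γ := by linarith
      rw [this]; ring
    linarith
  exact le_of_mul_le_mul_right h7 hden

/-- For `s < 1`, `A` may exceed `2 ^ s`, and `D * n ^ s` can then fail at size `2`. The witness uses
the smallest admissible values `1, 1, A` at sizes `0, 1, 2`, continued as a multiple of `n ^ s`;
`hAD` places it below `D * n ^ s`. -/
theorem exists_majorant_of_le_one (hβ : 0 ≤ β) (hγ : 0 ≤ γ) (hsum : β + γ = 1) (hA : 0 < A)
    (hD : 1 ≤ D) (hAD : A ≤ D * 2 ^ s) (hs0 : 0 ≤ s) (hs1 : s ≤ 1)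
    (h : A * (β + γ * (2 - 2 ^ (-s))) ≤ s + 1) :
    ∃ F : ℕ → ℝ, (∀ n, 0 ≤ F n) ∧ 1 ≤ F 0 ∧ 1 ≤ F 1 ∧ (∀ n, 1 ≤ n → F n ≤ D * (n : ℝ) ^ s) ∧
      ∀ n, 2 ≤ n → A * recSum β γ F n ≤ n * F n := by
  have hp2 : (2 : ℝ) ^ (-s) * 2 ^ s = 1 := by rw [← Real.rpow_add zero_lt_two]; simp
  have h' : A * (1 + γ * (1 - 2 ^ (-s))) ≤ s + 1 := by
    have : β + γ * (2 - 2 ^ (-s)) = 1 + γ * (1 - (2 : ℝ) ^ (-s)) := by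
      have : β = 1 - γ := by linarith
      rw [this]; ring
    rwa [this] at h
  have h3 := recSum_three_le hγ hsum hs0 hs1 h'
  have hp0 : 0 < (2 : ℝ) ^ (-s) := by positivity
  have hp1 : (2 : ℝ) ^ (-s) ≤ 1 := Real.rpow_le_one_of_one_le_of_nonpos one_le_two (by linarith)
  set p := (2 : ℝ) ^ (-s) with hp
  have hF : ∀ i : ℕ, 2 ≤ i → ¬ i < 2 := fun i hi => by omega
  refine ⟨fun i => if i < 2 then 1 else A * (p * (i : ℝ) ^ s), fun n => ?_, by simp, by simp,
    fun n hn => ?_, fun n hn => ?_⟩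
  · dsimp only
    split_ifs <;> positivity
  · dsimp only
    have hn' : (1 : ℝ) ≤ n := by exact_mod_cast hn
    split_ifs with hn2
    · obtain rfl : n = 1 := by omega
      simpa using hD
    · have h1 := mul_le_mul_of_nonneg_right hAD (by positivity : 0 ≤ p * (n : ℝ) ^ s)
      refine h1.trans (le_of_eq ?_)
      calc D * 2 ^ s * (p * (n : ℝ) ^ s) = D * (p * 2 ^ s) * (n : ℝ) ^ s := by ring
        _ = _ := by rw [hp2, mul_one]
  have hsumI : ∀ m, 2 ≤ m → ∑ i ∈ Finset.Ico m n, (if i < 2 then 1 else A * (p * (i : ℝ) ^ s)) =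
      A * (p * ∑ i ∈ Finset.Ico m n, (i : ℝ) ^ s) := fun m hm => by
    rw [Finset.mul_sum, Finset.mul_sum]
    refine Finset.sum_congr rfl fun i hi => ?_
    rw [if_neg (hF i (hm.trans (Finset.mem_Ico.1 hi).1))]
  -- Size `2` holds with equality and size `3` is `recSum_three_le`; the general estimate needs `(n
  -- / 2) ^ s ≥ 2 ^ s`, hence `n ≥ 4`.
  rcases Nat.lt_or_ge n 4 with hn4 | hn4
  · interval_cases n
    · simp only [recSum, Finset.sum_range_succ, Finset.sum_range_zero, Nat.reduceDiv, Nat.reduceAdd,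
        Finset.sum_Ico_succ_top (Nat.le_refl 1), Finset.Ico_self, Finset.sum_empty]
      norm_num
      rw [hp2]
      rw [show β * 2 + γ * 2 = 2 by linarith]
      linarith
    · simp only [recSum, Finset.sum_range_succ, Finset.sum_range_zero, Nat.reduceDiv, Nat.reduceAdd,
        Finset.sum_Ico_succ_top (show 1 ≤ 2 by omega), Finset.sum_Ico_succ_top (Nat.le_refl 1),
        Finset.sum_Ico_succ_top (Nat.le_refl 2), Finset.Ico_self, Finset.sum_empty]
      norm_num
      rw [hp2]
      have := mul_le_mul_of_nonneg_left h3 hA.le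
      linarith
  · have hn0 : 0 < n := by omega
    have hn4' : (4 : ℝ) ≤ n := by exact_mod_cast hn4
    have hfull := sum_Ico_two_rpow_add_le hs0 hs1 hn
    have hhalf := sum_halves_add_le_integral (monotoneOn_rpow_Ici_one hs0)
      ((Real.concaveOn_rpow hs0 hs1).subset (fun x hx =>
        Set.mem_Ici.2 (zero_le_one.trans (Set.mem_Ici.1 hx))) (convex_Ici _))
      (Real.continuous_rpow_const hs0).continuousOn hn
    rw [integral_half_rpow hs0 hn0, half_rpow n s, ← hp] at hhalf
    have hy : 1 ≤ (p * (n : ℝ) ^ s) * p := by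
      have h4 : (2 : ℝ) ^ s * 2 ^ s ≤ (n : ℝ) ^ s := by
        rw [← Real.mul_rpow zero_le_two zero_le_two]
        exact Real.rpow_le_rpow (by norm_num) (by linarith) hs0
      calc 1 = (p * 2 ^ s) * (p * 2 ^ s) := by rw [hp2]; ring
        _ = p * p * (2 ^ s * 2 ^ s) := by ring
        _ ≤ p * p * (n : ℝ) ^ s := mul_le_mul_of_nonneg_left h4 (by positivity)
        _ = _ := by ring
    have h1 := mul_le_mul_of_nonneg_left hfull hp0.le
    have h2 := mul_le_mul_of_nonneg_left hhalf hp0.le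
    have key := recSum_arith (A := A) (n := n) (y := p * (n : ℝ) ^ s)
      (X₁ := p * ∑ i ∈ Finset.Ico 2 n, (i : ℝ) ^ s)
      (X₂ := p * (∑ i ∈ Finset.Ico (n / 2) n, (i : ℝ) ^ s +
        ∑ i ∈ Finset.Ico ((n + 1) / 2) n, (i : ℝ) ^ s))
      hβ hγ hsum hs0 hp0 hp1 (by positivity) (by positivity) h' hy
      (by
        have e1 : p * ((n * (n : ℝ) ^ s - 2 * 2 ^ s) / (s + 1)) =
            (n * (p * (n : ℝ) ^ s) - 2 * (p * 2 ^ s)) / (s + 1) := by ring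
        rw [e1, hp2] at h1
        have e2 : p * (∑ i ∈ Finset.Ico 2 n, (i : ℝ) ^ s + ((n : ℝ) ^ s - 2 ^ s) / 2) =
            p * ∑ i ∈ Finset.Ico 2 n, (i : ℝ) ^ s + (p * (n : ℝ) ^ s - p * 2 ^ s) / 2 := by ring
        rw [e2, hp2] at h1
        linarith)
      (by
        refine le_trans (le_of_eq ?_) (h2.trans (le_of_eq ?_)) <;> ring)
    simp only [recSum, if_neg (hF n hn)]
    rw [hsumI _ (by omega), hsumI _ (by omega), ← Finset.sum_range_add_sum_Ico _ hn,
      hsumI _ le_rfl, Finset.sum_range_succ, Finset.sum_range_one]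
    norm_num
    have := mul_le_mul_of_nonneg_left key hA.le
    linarith

theorem exists_majorant_log (hβ : 0 ≤ β) (hγ : 0 ≤ γ) (hsum : β + γ = 1) (hA : 0 < A)
    (hD : 1 ≤ D) (hAD : A ≤ D * 2 ^ s) (hs0 : 0 ≤ s)
    (h : A * (β + γ * (2 - 2 ^ (-s))) ≤ s + 1) :
    ∃ F : ℕ → ℝ, (∀ n, 0 ≤ F n) ∧ 1 ≤ F 0 ∧ 1 ≤ F 1 ∧ (∀ n, 1 ≤ n → F n ≤ D * (n : ℝ) ^ s) ∧
      ∀ n, 2 ≤ n → A * recSum β γ F n ≤ n * F n := by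
  rcases le_total s 1 with hs1 | hs1
  · exact exists_majorant_of_le_one hβ hγ hsum hA hD hAD hs0 hs1 h
  · exact exists_majorant_of_one_le hβ hγ hA hD hs1 h

end Log

/-! ### The recursive inequality for the three over-approximations -/

section Majorants

variable {a f : LogLin} {β γ α : ℝ} {n : ℕ}

/-! ### Linear `f` -/

/-- The integral bounds for geometric sums. -/
theorem log_mul_geom_sums_le {X : ℝ} (hX : 1 < X) (n : ℕ) :
    Real.log X * ∑ i ∈ Finset.range n, X ^ i ≤ X ^ n - 1 ∧
      Real.log X * (∑ i ∈ Finset.Ico (n / 2) n, X ^ i + ∑ i ∈ Finset.Ico ((n + 1) / 2) n, X ^ i) ≤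
        2 * X ^ n - 2 * X ^ ((n : ℝ) / 2) := by
  have hX0 : 0 < X := by linarith
  have hlog : Real.log X ≤ X - 1 := Real.log_le_sub_one_of_pos hX0
  have hgeom : ∀ m, m ≤ n → Real.log X * ∑ i ∈ Finset.Ico m n, X ^ i ≤ X ^ n - X ^ m := by
    intro m hm
    rw [← geom_sum_Ico_mul X hm, mul_comm]
    exact mul_le_mul_of_nonneg_left hlog (by positivity)
  have h0 := hgeom 0 (Nat.zero_le n)
  have h1 := hgeom (n / 2) (by omega)
  have h2 := hgeom ((n + 1) / 2) (by omega)
  refine ⟨by simpa using h0, ?_⟩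
  have hsq : X ^ ((n : ℝ) / 2) * X ^ ((n : ℝ) / 2) = X ^ (n / 2) * X ^ ((n + 1) / 2) := by
    rw [← Real.rpow_add hX0, add_halves, Real.rpow_natCast, ← pow_add]
    congr 1
    omega
  have hY : 0 < X ^ ((n : ℝ) / 2) := by positivity
  have hu : 0 < X ^ (n / 2) := by positivity
  have hv : 0 < X ^ ((n + 1) / 2) := by positivity
  -- AM–GM, since `⌊n/2⌋ + ⌈n/2⌉ = n`: this is why both roundings may be replaced by `n/2`.
  have ham : 2 * X ^ ((n : ℝ) / 2) ≤ X ^ (n / 2) + X ^ ((n + 1) / 2) := by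
    refine le_of_sq_le_sq ?_ (by positivity)
    nlinarith [sq_nonneg (X ^ (n / 2) - X ^ ((n + 1) / 2))]
  linarith

theorem recSum_le_of_linear (hβ : 0 ≤ β) (hγ : 0 ≤ γ) (hα : 1 < α) (hnlog : f.nlog = 0)
    (hlog : f.log = 0) (hlin : 0 < f.lin)
    (h : 0 ≤ listValue ⟨0, 1, 0, 0⟩ α n
        [⟨[⟨f.lin, 0, true⟩], f⟩,
         ⟨[⟨-(2 * γ), f.lin, false⟩, ⟨2 * γ, f.lin / 2, false⟩,
            ⟨-β, f.lin, false⟩, ⟨β, 0, false⟩], a + ⟨0, 0, 0, f.const⟩⟩]) :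
    α ^ a.eval n * recSum β γ (fun i => α ^ f.eval i) n ≤ n * α ^ f.eval n := by
  have hα0 : 0 < α := by linarith
  have hX : 1 < α ^ f.lin := Real.one_lt_rpow hα hlin
  have hlogX : 0 < Real.log (α ^ f.lin) := Real.log_pos hX
  have hg : LogLin.eval ⟨0, 1, 0, 0⟩ n = n := by simp [LogLin.eval]
  have hd : LogLin.eval ⟨0, 0, 0, f.const⟩ n = f.const := by simp [LogLin.eval]
  have hf : ∀ i : ℕ, α ^ f.eval i = α ^ f.const * (α ^ f.lin) ^ i := by
    intro i
    rw [← Real.rpow_natCast, ← Real.rpow_mul hα0.le, ← Real.rpow_add hα0]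
    congr 1
    simp only [LogLin.eval, hnlog, hlog]
    ring
  have e1 : (α ^ (n : ℝ)) ^ f.lin = (α ^ f.lin) ^ n := by
    rw [← Real.rpow_natCast, ← Real.rpow_mul hα0.le, ← Real.rpow_mul hα0.le, mul_comm]
  have e2 : (α ^ (n : ℝ)) ^ (f.lin / 2) = (α ^ f.lin) ^ ((n : ℝ) / 2) := by
    rw [← Real.rpow_mul hα0.le, ← Real.rpow_mul hα0.le]
    congr 1
    ring
  simp only [listValue, Term.value, Psi.eval, List.map_cons, List.map_nil, List.sum_cons,
    List.sum_nil, hg, LogLin.eval_add, hd, Real.rpow_add hα0, e1, e2, Real.rpow_zero, if_true,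
    Bool.false_eq_true, if_false, Real.log_rpow hα0] at h
  obtain ⟨h1, h2⟩ := log_mul_geom_sums_le hX n
  have h3 := add_le_add (mul_le_mul_of_nonneg_left h1 hβ) (mul_le_mul_of_nonneg_left h2 hγ)
  have h4 := mul_le_mul_of_nonneg_left h3
    (by positivity : 0 ≤ α ^ a.eval n * α ^ f.const)
  refine le_of_mul_le_mul_left ?_ hlogX
  have e3 : Real.log (α ^ f.lin) * (n * α ^ f.eval n) =
      f.lin * (n * Real.log α) * α ^ f.eval n := by
    rw [Real.log_rpow hα0]; ring
  rw [e3]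
  simp only [recSum, hf, ← Finset.mul_sum] at h ⊢
  linarith

/-! ### Sampling -/

theorem sum_map_flatMap_range {ι : Type*} (φ : ι → ℝ) (u : ℕ → List ι) (B : ℕ) :
    (((List.range B).flatMap u).map φ).sum = ∑ j ∈ Finset.range B, ((u j).map φ).sum := by
  induction B with
  | zero => simp
  | succ B ih => simp [List.range_succ, Finset.sum_range_succ, ← ih]

theorem LogLin.nlog_nonneg_of_monotoneOn (hlog : f.log = 0)
    (hm : MonotoneOn f.eval (Set.Ici 1)) : 0 ≤ f.nlog := by
  by_contra! hneg
  -- At `x = exp y` the growing part of `f` is `-(|f.lin| + 1) * x < f.lin`, so `f(x) < f(1)`.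
  set y : ℝ := (|f.lin| + f.lin + 1) / -f.nlog with hy
  have hpos : 0 < -f.nlog := by linarith
  have hq := neg_abs_le f.lin
  have hy0 : 0 ≤ y := div_nonneg (by linarith) hpos.le
  have hy' : f.nlog * y + f.lin = -(|f.lin| + 1) := by
    have : f.nlog * y = -(|f.lin| + f.lin + 1) := by
      rw [hy, div_neg, mul_neg, mul_div_cancel₀ _ hneg.ne]
    linarith
  have hx : 1 ≤ Real.exp y := Real.one_le_exp hy0
  have h := hm Set.self_mem_Ici hx hx
  simp only [LogLin.eval, hlog, Real.log_exp, Real.log_one] at h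
  have h2 : f.nlog * (Real.exp y * y) + f.lin * Real.exp y = -(|f.lin| + 1) * Real.exp y := by
    rw [← hy']; ring
  nlinarith [abs_nonneg f.lin]

theorem LogLin.convexOn_eval (hlog : f.log = 0) (hp : 0 ≤ f.nlog) :
    ConvexOn ℝ (Set.Ici 0) f.eval := by
  have h1 := (Real.convexOn_mul_log.smul hp)
  refine ⟨convex_Ici 0, fun x hx y hy p q hp hq hpq => ?_⟩
  have := h1.2 hx hy hp hq hpq
  simp only [smul_eq_mul, LogLin.eval, hlog] at this ⊢
  have hc : f.const = p * f.const + q * f.const := by rw [← add_mul, hpq, one_mul]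
  linarith

theorem LogLin.continuous_eval (hlog : f.log = 0) : Continuous f.eval := by
  have h : f.eval = fun x => f.nlog * (x * Real.log x) + f.lin * x + f.const := by
    funext x
    simp [LogLin.eval, hlog]
  rw [h]
  have := Real.continuous_mul_log
  fun_prop

theorem convexOn_rpow_comp {s : Set ℝ} {u : ℝ → ℝ} (hα : 1 < α) (hu : ConvexOn ℝ s u) :
    ConvexOn ℝ s fun x => α ^ u x := by
  have hα0 : 0 < α := by linarith
  refine ⟨hu.1, fun x hx y hy p q hp hq hpq => ?_⟩
  have h1 := Real.rpow_le_rpow_of_exponent_le hα.le (hu.2 hx hy hp hq hpq)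
  refine h1.trans ?_
  have h2 := convexOn_exp.2 (Set.mem_univ (Real.log α * u x)) (Set.mem_univ (Real.log α * u y))
    hp hq hpq
  simp only [smul_eq_mul, Real.rpow_def_of_pos hα0] at h2 ⊢
  refine (le_of_eq ?_).trans h2
  congr 1
  ring

/-- The half sums live on `[n/2, n]` with `n/2 ≥ 1`, so monotonicity suffices. The full sum reaches
into `[0, 1]`, where `f` may decrease (as `n ln n` does); there convexity of `α ^ f` and `f(0) ≤
f(1)` take over. -/
theorem recSum_le_of_sampled {B : ℕ} (hB : 0 < B) {θ : ℝ} (hθ : 1 ≤ θ) (hβ : 0 ≤ β)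
    (hγ : 0 ≤ γ) (hα : 1 < α) (hn : 2 ≤ n) (hmono : MonotoneOn f.eval (Set.Ici 1))
    (hzero : β ≠ 0 → f.log = 0 ∧ f.eval 0 ≤ f.eval 1) {g : LogLin}
    (h : 0 ≤ listValue g α n
        (⟨[⟨B, 0, false⟩], f⟩ ::
          (List.range B).flatMap fun j =>
            [⟨[⟨-(θ * γ), 0, false⟩], a + f.scale ((B + (j + 1)) / (2 * B))⟩,
             ⟨[⟨-β, 0, false⟩], a + f.scale ((j + 1) / B)⟩])) :
    α ^ a.eval n * recSum β γ (fun i => α ^ f.eval i) n ≤ n * α ^ f.eval n := by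
  have hα0 : 0 < α := by linarith
  have hB' : (0 : ℝ) < B := by exact_mod_cast hB
  have hn2 : (2 : ℝ) ≤ n := by exact_mod_cast hn
  have hn0 : (0 : ℝ) < n := by linarith
  set G : ℝ → ℝ := fun x => α ^ f.eval x with hG
  have hG0 : ∀ x, 0 ≤ G x := fun x => by positivity
  have hGm : MonotoneOn G (Set.Ici 1) := fun x hx y hy hxy =>
    Real.rpow_le_rpow_of_exponent_le hα.le (hmono hx hy hxy)
  set S₁ := ∑ j ∈ Finset.range B, G (n * (((j : ℝ) + 1) / B)) with hS₁
  set S₂ := ∑ j ∈ Finset.range B, G (n * (((B : ℝ) + ((j : ℝ) + 1)) / (2 * B))) with hS₂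
  have hS₂0 : 0 ≤ S₂ := Finset.sum_nonneg fun j _ => hG0 _
  have hval : α ^ a.eval n * (θ * γ * S₂ + β * S₁) ≤ B * G n := by
    -- The index `j` runs over the real casts of `List.range B`; the rewriting moves the cast into
    -- the summands.
    rw [listValue, List.map_cons, List.sum_cons, bind_pure_comp, List.map_eq_map,
      List.flatMap_map, sum_map_flatMap_range] at h
    simp only [Term.value, Psi.eval, List.map_cons, List.map_nil, List.sum_cons, List.sum_nil,
      LogLin.eval_add, Real.rpow_add hα0, Real.rpow_zero, Bool.false_eq_true, if_false] at h
    have e : ∀ j : ℕ, α ^ (f.scale (((B : ℝ) + (j + 1)) / (2 * B))).eval n =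
        G (n * (((B : ℝ) + ((j : ℝ) + 1)) / (2 * B))) ∧
        α ^ (f.scale (((j : ℝ) + 1) / B)).eval n = G (n * (((j : ℝ) + 1) / B)) := fun j => by
      rw [f.eval_scale (by positivity) hn0, f.eval_scale (by positivity) hn0]
      exact ⟨rfl, rfl⟩
    have e' : α ^ a.eval n * (θ * γ * S₂ + β * S₁) = -∑ j ∈ Finset.range B,
        ((-(θ * γ) * 1 * 1 + 0) *
            (α ^ a.eval n * α ^ (f.scale (((B : ℝ) + (j + 1)) / (2 * B))).eval n) +
          ((-β * 1 * 1 + 0) * (α ^ a.eval n * α ^ (f.scale (((j : ℝ) + 1) / B)).eval n) + 0)) := by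
      simp only [hS₁, hS₂, Finset.mul_sum, ← Finset.sum_add_distrib, ← Finset.sum_neg_distrib, e]
      refine Finset.sum_congr rfl fun j _ => ?_
      ring
    rw [e']
    linarith
  have hhalf : ∑ i ∈ Finset.Ico (n / 2) n, G i + ∑ i ∈ Finset.Ico ((n + 1) / 2) n, G i ≤
      n / B * S₂ := by
    have h1 := integral_le_riemann_of_monotoneOn (u := (n : ℝ) / 2) (v := n) (by linarith)
      (hGm.mono fun x hx => by have := hx.1; simp only [Set.mem_Ici]; linarith) hB
    refine (sum_halves_le_integral hGm hn).trans ((mul_le_mul_of_nonneg_left h1 zero_le_two).trans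
      (le_of_eq ?_))
    rw [← mul_assoc, hS₂]
    congr 1
    · ring
    · refine Finset.sum_congr rfl fun j _ => ?_
      congr 1
      field_simp
      ring
  have hfull : β * ∑ i ∈ Finset.range n, G i ≤ β * (n / B * S₁) := by
    rcases eq_or_ne β 0 with rfl | hβ0
    · simp
    obtain ⟨hlog, h01⟩ := hzero hβ0
    refine mul_le_mul_of_nonneg_left ?_ hβ
    have hconv : ConvexOn ℝ (Set.Ici 0) G := convexOn_rpow_comp hα
      (LogLin.convexOn_eval hlog (LogLin.nlog_nonneg_of_monotoneOn hlog hmono))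
    have hcont : ContinuousOn G (Set.Ici 0) :=
      ((Real.continuous_const_rpow hα0.ne').comp (LogLin.continuous_eval hlog)).continuousOn
    have hG01 : G 0 ≤ G 1 := Real.rpow_le_rpow_of_exponent_le hα.le h01
    have hG0n : G 0 ≤ G n := hG01.trans
      (hGm Set.self_mem_Ici (by simp only [Set.mem_Ici]; linarith) (by linarith))
    exact (sum_range_le_integral hconv hcont hGm hG01 hn).trans
      (integral_le_riemann_of_convexOn hconv hcont hn0 hG0n hB)
  have hrec : recSum β γ (fun i => α ^ f.eval i) n ≤ n / B * (θ * γ * S₂ + β * S₁) := by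
    have h1 := mul_le_mul_of_nonneg_left hhalf hγ
    have h2 : γ * (n / B * S₂) ≤ θ * (γ * (n / B * S₂)) :=
      le_mul_of_one_le_left (by positivity) hθ
    have h3 : recSum β γ (fun i => α ^ f.eval i) n = β * ∑ i ∈ Finset.range n, G i +
      γ * (∑ i ∈ Finset.Ico (n / 2) n, G i + ∑ i ∈ Finset.Ico ((n + 1) / 2) n, G i) := rfl
    linarith
  calc α ^ a.eval n * recSum β γ (fun i => α ^ f.eval i) n
      ≤ α ^ a.eval n * (n / B * (θ * γ * S₂ + β * S₁)) :=
        mul_le_mul_of_nonneg_left hrec (by positivity)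
    _ = n / B * (α ^ a.eval n * (θ * γ * S₂ + β * S₁)) := by ring
    _ ≤ n / B * (B * G n) := mul_le_mul_of_nonneg_left hval (by positivity)
    _ = n * α ^ f.eval n := by field_simp; rfl

/-- Here `α ^ f(x)` cancels and no size is left, so the inequality at a single `x` yields the
recurrence at every `n ≥ 2`. The parameters are `s = f.log * ln α`, `A = α ^ a`, `D = α ^ f.const`;
`f(1) ≥ 0` gives `D ≥ 1`, and `a(2) ≤ f(2)` gives `A ≤ D * 2 ^ s`. -/
theorem exists_majorant_of_logarithmic (hβ : 0 ≤ β) (hγ : 0 ≤ γ) (hsum : β + γ = 1) (hα : 1 < α)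
    (hnlog : f.nlog = 0) (hlin : f.lin = 0) (hlog : 0 < f.log)
    (hann : a.nlog = 0) (han : a.lin = 0) (hal : a.log = 0)
    (hf1 : 0 ≤ f.eval 1) (hf2 : a.eval 2 ≤ f.eval 2) {x : ℝ}
    (h : 0 ≤ listValue ⟨0, 0, 0, 1⟩ α x
        [⟨[⟨1, 0, false⟩, ⟨f.log, 0, true⟩], f⟩,
         ⟨[⟨-(2 * γ), 0, false⟩, ⟨γ, -(f.log * Real.log 2), false⟩, ⟨-β, 0, false⟩], a + f⟩]) :
    ∃ F : ℕ → ℝ, (∀ n, 0 ≤ F n) ∧ 1 ≤ F 0 ∧ 1 ≤ F 1 ∧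
      (∀ n : ℕ, 1 ≤ n → F n ≤ α ^ f.eval n) ∧
      ∀ n : ℕ, 2 ≤ n → α ^ a.eval n * recSum β γ F n ≤ n * F n := by
  have hα0 : 0 < α := by linarith
  have ha : ∀ y, a.eval y = a.const := fun y => by simp [LogLin.eval, hann, han, hal]
  have hpow : ∀ y : ℝ, 0 < y → α ^ (f.log * Real.log y) = y ^ (f.log * Real.log α) := by
    intro y hy
    rw [Real.rpow_def_of_pos hα0, Real.rpow_def_of_pos hy]
    congr 1
    ring
  have hf : ∀ y : ℝ, 0 < y → α ^ f.eval y = α ^ f.const * y ^ (f.log * Real.log α) := by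
    intro y hy
    rw [← hpow y hy, ← Real.rpow_add hα0]
    congr 1
    simp only [LogLin.eval, hnlog, hlin]
    ring
  have hs : 0 ≤ f.log * Real.log α := mul_nonneg hlog.le (Real.log_nonneg hα.le)
  have hD : 1 ≤ α ^ f.const := by
    have := Real.one_le_rpow hα.le hf1
    rwa [hf 1 one_pos, Real.one_rpow, mul_one] at this
  have hAD : α ^ a.const ≤ α ^ f.const * 2 ^ (f.log * Real.log α) := by
    rw [← hf 2 two_pos, ← ha 2]
    exact Real.rpow_le_rpow_of_exponent_le hα.le hf2
  have hmain : α ^ a.const * (β + γ * (2 - 2 ^ (-(f.log * Real.log α)))) ≤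
      f.log * Real.log α + 1 := by
    have hg : LogLin.eval ⟨0, 0, 0, 1⟩ x = 1 := by simp [LogLin.eval]
    have e : α ^ (-(f.log * Real.log 2)) = 2 ^ (-(f.log * Real.log α)) := by
      rw [Real.rpow_neg hα0.le, Real.rpow_neg zero_le_two, hpow 2 two_pos]
    simp only [listValue, Term.value, Psi.eval, List.map_cons, List.map_nil, List.sum_cons,
      List.sum_nil, hg, LogLin.eval_add, Real.rpow_add hα0, Real.rpow_one, e, Real.rpow_zero,
      if_true, Bool.false_eq_true, if_false, ha] at h
    have hfx : 0 < α ^ f.eval x := by positivity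
    refine le_of_mul_le_mul_left ?_ hfx
    linarith
  obtain ⟨F, h0, h1, h2, h3, h4⟩ := exists_majorant_log hβ hγ hsum
    (Real.rpow_pos_of_pos hα0 a.const) hD hAD hs hmain
  refine ⟨F, h0, h1, h2, fun n hn => ?_, fun n hn => ?_⟩
  · rw [hf n (by exact_mod_cast hn)]
    exact h3 n hn
  · rw [ha]
    exact h4 n hn

/-- The inequality at the start of the simplification yields a solution of the recursive
inequality that lies below `α ^ f`. -/
theorem Start.exists_majorant {g : LogLin} {e : List Term} (hs : Start a β γ f g e)
    (hβ : 0 ≤ β) (hγ : 0 ≤ γ) (hsum : β + γ = 1) (hα : 1 < α) {N : ℕ} (hN : 2 ≤ N)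
    (hf0 : 0 ≤ f.eval 0) (hf1 : 0 ≤ f.eval 1) (hf2 : a.eval 2 ≤ f.eval 2)
    (h : ∀ n : ℕ, 2 ≤ n → n ≤ N → 0 ≤ listValue g α n e) :
    ∃ F : ℕ → ℝ, (∀ n, 0 ≤ F n) ∧ 1 ≤ F 0 ∧ 1 ≤ F 1 ∧
      (∀ n : ℕ, 1 ≤ n → F n ≤ α ^ f.eval n) ∧
      ∀ n : ℕ, 2 ≤ n → n ≤ N → α ^ a.eval n * recSum β γ F n ≤ n * F n := by
  have hα0 : 0 < α := by linarith
  have h0 : (1 : ℝ) ≤ α ^ f.eval ((0 : ℕ) : ℝ) := by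
    rw [Nat.cast_zero]; exact Real.one_le_rpow hα.le hf0
  have h1 : (1 : ℝ) ≤ α ^ f.eval ((1 : ℕ) : ℝ) := by
    rw [Nat.cast_one]; exact Real.one_le_rpow hα.le hf1
  cases hs with
  | linear hnlog hlog hlin =>
    exact ⟨fun i => α ^ f.eval i, fun n => by positivity, h0, h1, fun n _ => le_rfl,
      fun n hn hnN => recSum_le_of_linear hβ hγ hα hnlog hlog hlin (h n hn hnN)⟩
  | logarithmic hnlog hlin hlog hann han hal =>
    obtain ⟨F, k0, k1, k2, k3, k4⟩ := exists_majorant_of_logarithmic hβ hγ hsum hα hnlog hlin hlog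
      hann han hal hf1 hf2 (h 2 le_rfl hN)
    exact ⟨F, k0, k1, k2, k3, fun n hn _ => k4 n hn⟩
  | sampled B hB θ hθ hmono hzero =>
    exact ⟨fun i => α ^ f.eval i, fun n => by positivity, h0, h1, fun n _ => le_rfl,
      fun n hn hnN => recSum_le_of_sampled hB hθ hβ hγ hα hn hmono hzero (h n hn hnN)⟩

end Majorants

/-! ### The moment bound and soundness -/

/-- The exponential moment bound behind the reported tail bound. -/
theorem lintegral_rpow_law_le {t : RecExpr} (ht : t.IsSingleCall) {f : GExpr}
    (hf : ∀ n : ℕ, ∫ x, x ∂(t.law n) ≤ f.eval n) {N : ℕ} (hN : 1 ≤ N) {g : LogLin} {ψ : Psi}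
    {c α : ℝ} (hψ : ReducesTo t f N g ψ) (hsep : ProvedSeparable ψ) (hc : Threshold ψ c)
    (hα : 1 < α) (hαc : α ^ g.eval N ≤ c) :
    ∫⁻ x, ENNReal.ofReal (α ^ x) ∂t.law N ≤ ENNReal.ofReal (α ^ f.eval N) := by
  have hα0 : 0 < α := by linarith
  have hf0 : 0 ≤ f.eval 0 := by simpa [RecExpr.law_zero] using hf 0
  have hf1 : 0 ≤ f.eval 1 := by simpa [RecExpr.law_one] using hf 1
  have hf2 : t.cost.eval 2 ≤ f.eval 2 := by simpa [ht.law_two] using hf 2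
  -- For `N = 1` no size `n ≥ 2` provides a starting inequality, but `T(1) = 0` and `f(1) ≥ 0`
  -- settle it.
  rcases hN.eq_or_lt with rfl | hN2
  · rw [RecExpr.law_one, lintegral_dirac, Real.rpow_zero, Nat.cast_one]
    exact ENNReal.ofReal_le_ofReal (Real.one_le_rpow hα.le hf1)
  · obtain ⟨e, hs, he⟩ := exists_start_nonneg hψ hsep hc hα hαc
    simp only [← GExpr.eval_norm] at hf0 hf1 hf2 ⊢
    obtain ⟨F, h0, h1, h2, h3, h4⟩ := hs.exists_majorant ht.full_nonneg ht.half_nonneg ht.total hα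
      hN2 hf0 hf1 hf2 he
    refine (ht.lintegral_rpow_le hα0 h0 h1 h2 (fun n hn hnN => ?_) le_rfl).trans
      (ENNReal.ofReal_le_ofReal (h3 N hN))
    have hn0 : (0 : ℝ) < n := by exact_mod_cast (by omega : 0 < n)
    rw [t.sum_callProb_mul, ← mul_div_assoc, div_le_iff₀ hn0, mul_comm (F n)]
    exact h4 n hn hnN

end TailBound

theorem mainTheorem6 (t : TailBound.RecExpr) (ht : t.IsSingleCall)
    (f : TailBound.GExpr) (hf : ∀ n : ℕ, ∫ x, x ∂(t.law n) ≤ f.eval n)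
    (N : ℕ) (hN : 1 ≤ N) (out : Option ℝ) (hout : TailBound.Synthesizes t f N out)
    (κ : TailBound.GExpr) (hκ : f.eval N ≤ κ.eval N) :
    t.law N {x | κ.eval N ≤ x} ≤
      ENNReal.ofReal (TailBound.reportedBound f N (κ.eval N) out) := by
  cases hout with
  | failure =>
    have := ht.isProbabilityMeasure_law N
    rw [TailBound.reportedBound, ENNReal.ofReal_one]
    exact prob_le_one
  | success g ψ c α hψ hsep hc hα hαc =>
    exact TailBound.RecExpr.measure_ge_le_of_lintegral_rpow_le hα
      (TailBound.lintegral_rpow_law_le ht hf hN hψ hsep hc hα hαc)
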